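/- For every real number $\alpha<1$ there is a constant $c_\alpha>0$, depending only on $\alpha$, with the following property. If $P$ is a finite set of $n$ points in $\mathbb R^3$ such that every plane in $\mathbb R^3$ contains at most $\alpha n$ points of $P$, then there are at least $c_\alpha n^2$ ordinary lines for $P$, where an ordinary line for $P$ is a line in $\mathbb R^3$ that contains exactly two points of $P$. -/

import Mathlib

/-- Euclidean three-space. -/
abbrev Space3 : Type := EuclideanSpace ℝ (Fin 3)

/-- A line in three-space: an affine subspace of dimension one. It is automatically nonempty,
since the direction of the empty affine subspace has dimension zero. -/
def IsLine (l : AffineSubspace ℝ Space3) : Prop :=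
  Module.finrank ℝ l.direction = 1

/-- A plane in three-space: an affine subspace of dimension two, automatically nonempty. -/
def IsPlane (p : AffineSubspace ℝ Space3) : Prop :=
  Module.finrank ℝ p.direction = 2

/-- The ordinary lines of a finite point set: the lines that contain exactly two of its points. -/
def ordinaryLines (P : Finset Space3) : Set (AffineSubspace ℝ Space3) :=
  {l | IsLine l ∧ ((P : Set Space3) ∩ (l : Set Space3)).ncard = 2}

/-! By Sylvester–Gallai every plane spanned by `P` contains an ordinary line. That line holds only
two of the at least three points of `P` in the plane, so at least a third of those points lie off
it, and the line together with any such point recovers the plane. Hence the incidences between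
points and spanned planes number at most `3n` times the ordinary lines (`card_mul_le_ordinary`). It
therefore suffices that linearly many points each lie on quadratically many spanned planes.

Planes through a point `a` are lines in the projection from `a`. Beck's theorem supplies
quadratically many of them once every spanned plane through `a` is left by linearly many directions
from `a` (`exists_card_planes_through_ge`). The hypothesis puts `(1 - α)n` points off each plane;
the only danger is that too many share a direction. Szemerédi–Trotter, summed dyadically, shows that
few pairs span a line with between `K` and `βn` points. So if no line has more than `βn` points, at
least half of the points are suitable centres.

If some line has at least `βn` points, there are two cases. Either linearly many points off it lie
with it in sparsely filled planes, and each sends linearly many ordinary lines to it directly; or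
two planes through it hold linearly many further points each, and those in the first plane are
suitable centres.

Beck's theorem and the pair estimate both rest on the rich-lines bound, obtained here from the
crossing lemma for straight-line graphs. -/

/-! ### Straight-line graphs without crossings -/

/-- The slope of the segment `e`. -/
noncomputable def segSlope (e : (ℝ × ℝ) × (ℝ × ℝ)) : ℝ := (e.2.2 - e.1.2) / (e.2.1 - e.1.1)

/-- The height at abscissa `x` of the line carrying the segment `e`. -/
noncomputable def segHeight (e : (ℝ × ℝ) × (ℝ × ℝ)) (x : ℝ) : ℝ :=
  e.1.2 + segSlope e * (x - e.1.1)

theorem segHeight_left (e : (ℝ × ℝ) × (ℝ × ℝ)) : segHeight e e.1.1 = e.1.2 := by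
  simp [segHeight]

theorem segHeight_eq_right (e : (ℝ × ℝ) × (ℝ × ℝ)) (h : e.1.1 < e.2.1) (x : ℝ) :
    segHeight e x = e.2.2 - segSlope e * (e.2.1 - x) := by
  have : e.2.1 - e.1.1 ≠ 0 := by linarith
  unfold segHeight segSlope
  field_simp
  ring

theorem segHeight_right (e : (ℝ × ℝ) × (ℝ × ℝ)) (h : e.1.1 < e.2.1) :
    segHeight e e.2.1 = e.2.2 := by
  rw [segHeight_eq_right e h]; ring

theorem exists_segHeight_eq (e f : (ℝ × ℝ) × (ℝ × ℝ)) {x₁ x₂ : ℝ} (hx : x₁ < x₂)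
    (h₁ : segHeight e x₁ < segHeight f x₁) (h₂ : segHeight f x₂ < segHeight e x₂) :
    ∃ x, x₁ < x ∧ x < x₂ ∧ segHeight e x = segHeight f x := by
  have hc : ContinuousOn (fun x => segHeight e x - segHeight f x) (Set.Icc x₁ x₂) := by
    unfold segHeight; fun_prop
  obtain ⟨x, hx, h0⟩ := intermediate_value_Ioo hx.le hc
    (show (0 : ℝ) ∈ Set.Ioo _ _ from ⟨by simpa using h₁, by simpa using h₂⟩)
  exact ⟨x, hx.1, hx.2, sub_eq_zero.1 h0⟩

/-- Two segments cross if their relative interiors meet. -/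
def SegCross (e f : (ℝ × ℝ) × (ℝ × ℝ)) : Prop :=
  ∃ x, e.1.1 < x ∧ x < e.2.1 ∧ f.1.1 < x ∧ x < f.2.1 ∧ segHeight e x = segHeight f x

/-- A graph drawn with straight segments, whose vertices have distinct abscissae and do not lie
in the interior of an edge. -/
structure IsGeomGraph (V : Finset (ℝ × ℝ)) (E : Finset ((ℝ × ℝ) × (ℝ × ℝ))) : Prop where
  inj : ∀ v ∈ V, ∀ w ∈ V, v.1 = w.1 → v = w
  left_mem : ∀ e ∈ E, e.1 ∈ V
  right_mem : ∀ e ∈ E, e.2 ∈ V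
  lt : ∀ e ∈ E, e.1.1 < e.2.1
  avoid : ∀ e ∈ E, ∀ w ∈ V, e.1.1 < w.1 → w.1 < e.2.1 → segHeight e w.1 ≠ w.2

/-- The segment `e` is the first one met when descending from the point `w`. -/
def DirectlyBelow (E : Finset ((ℝ × ℝ) × (ℝ × ℝ))) (w : ℝ × ℝ) (e : (ℝ × ℝ) × (ℝ × ℝ)) : Prop :=
  e.1.1 < w.1 ∧ w.1 < e.2.1 ∧ segHeight e w.1 < w.2 ∧
    ∀ f ∈ E, f.1.1 < w.1 → w.1 < f.2.1 → segHeight f w.1 < w.2 →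
      segHeight f w.1 ≤ segHeight e w.1

theorem DirectlyBelow.unique {E : Finset ((ℝ × ℝ) × (ℝ × ℝ))}
    (hE : ∀ e ∈ E, ∀ f ∈ E, e ≠ f → ¬ SegCross e f) {w : ℝ × ℝ} {e f : (ℝ × ℝ) × (ℝ × ℝ)}
    (he : e ∈ E) (hf : f ∈ E) (hwe : DirectlyBelow E w e) (hwf : DirectlyBelow E w f) : e = f := by
  by_contra hne
  refine hE e he f hf hne ⟨w.1, hwe.1, hwe.2.1, hwf.1, hwf.2.1, le_antisymm ?_ ?_⟩
  · exact hwf.2.2.2 e he hwe.1 hwe.2.1 hwe.2.2.1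
  · exact hwe.2.2.2 f hf hwf.1 hwf.2.1 hwf.2.2.1

/-- Let `b` be the next edge above `e` at its left end. The wedge between `e` and `b` contains a
vertex, and from the leftmost one the descent meets `e` first: an intervening edge, followed to the
left, can neither leave the wedge, nor start at its apex, nor start inside it. -/
theorem IsGeomGraph.exists_directlyBelow {V : Finset (ℝ × ℝ)} {E : Finset ((ℝ × ℝ) × (ℝ × ℝ))}
    (hG : IsGeomGraph V E) (hE : ∀ e ∈ E, ∀ f ∈ E, e ≠ f → ¬ SegCross e f)
    {e : (ℝ × ℝ) × (ℝ × ℝ)} (he : e ∈ E)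
    (h₁ : ∃ f ∈ E, f.1 = e.1 ∧ segSlope e < segSlope f)
    (h₂ : ∃ f ∈ E, f.2 = e.2 ∧ segSlope f < segSlope e) :
    ∃ w ∈ V, DirectlyBelow E w e := by
  classical
  obtain ⟨b, hb, hbmin⟩ := Finset.exists_min_image
    (E.filter fun f => f.1 = e.1 ∧ segSlope e < segSlope f) segSlope
    (by obtain ⟨f, hf, h⟩ := h₁; exact ⟨f, Finset.mem_filter.2 ⟨hf, h⟩⟩)
  obtain ⟨hbE, hbe, hbs⟩ := Finset.mem_filter.1 hb
  obtain ⟨u, huE, hue, hus⟩ := h₂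
  have hel := hG.lt e he
  have hbl := hG.lt b hbE
  have hul := hG.lt u huE
  have heb : e ≠ b := fun h => by rw [h] at hbs; exact lt_irrefl _ hbs
  -- above the edge `e`, the edge `b` is higher
  have hbh : ∀ x, e.1.1 < x → segHeight e x < segHeight b x := fun x hx => by
    have := mul_lt_mul_of_pos_right hbs (sub_pos.2 hx)
    simp only [segHeight, hbe]; linarith
  have huh : ∀ x, x < e.2.1 → segHeight e x < segHeight u x := fun x hx => by
    have := mul_lt_mul_of_pos_right hus (sub_pos.2 hx)
    rw [segHeight_eq_right e hel, segHeight_eq_right u hul, hue]; linarith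
  have hub : u ≠ b := fun h => by rw [h] at hus; exact lt_asymm hbs hus
  have hbe1 : b.1.1 = e.1.1 := by rw [hbe]
  have hue1 : u.2.1 = e.2.1 := by rw [hue]
  set W := V.filter fun w => e.1.1 < w.1 ∧ w.1 < e.2.1 ∧ w.1 ≤ b.2.1 ∧
    segHeight e w.1 < w.2 ∧ w.2 ≤ segHeight b w.1 with hW
  -- Either `b` ends above `e`, and its right end works; or `b` reaches past `e`, and then `u`,
  -- which ends at `e.2` below `b`, cannot get above `b` and so must start inside the wedge.
  have hWne : W.Nonempty := by
    rcases lt_or_ge b.2.1 e.2.1 with hlt | hge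
    · refine ⟨b.2, Finset.mem_filter.2 ⟨hG.right_mem b hbE, ?_, hlt, le_rfl, ?_, ?_⟩⟩
      · linarith
      · rw [← segHeight_right b hbl]; exact hbh _ (by linarith)
      · rw [segHeight_right b hbl]
    · have hcross : ∀ x, e.1.1 ≤ x → x < e.2.1 → u.1.1 ≤ x →
          segHeight b x < segHeight u x → False := by
        intro x hx1 hx2 hx3 hx4
        obtain ⟨y, hy1, hy2, hy3⟩ := exists_segHeight_eq b u hx2 hx4 (by
          rw [← hue1, segHeight_right u hul, hue, ← segHeight_right e hel]; exact hbh _ hel)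
        exact hE b hbE u huE hub.symm ⟨y, by linarith, by linarith, by linarith, by linarith, hy3⟩
      have hu2 : e.1.1 < u.1.1 := by
        by_contra hcon
        push Not at hcon
        refine hcross e.1.1 le_rfl hel hcon ?_
        rw [← hbe1, segHeight_left, hbe, ← segHeight_left e]
        exact huh _ hel
      have hu3 : u.1.1 < e.2.1 := by linarith
      refine ⟨u.1, Finset.mem_filter.2 ⟨hG.left_mem u huE, hu2, hu3, by linarith, ?_, ?_⟩⟩
      · rw [← segHeight_left u]; exact huh _ hu3
      · by_contra hcon
        push Not at hcon
        exact hcross u.1.1 hu2.le hu3 le_rfl (by rwa [segHeight_left])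
  obtain ⟨w, hw, hwmin⟩ := Finset.exists_min_image W Prod.fst hWne
  obtain ⟨hwV, hw1, hw2, hw3, hw4, hw5⟩ := Finset.mem_filter.1 hw
  refine ⟨w, hwV, hw1, hw2, hw4, fun f hf hf1 hf2 hf3 => ?_⟩
  by_contra hcon
  push Not at hcon
  have hfe : e ≠ f := fun h => by rw [h] at hcon; exact lt_irrefl _ hcon
  have hfb : f ≠ b := fun h => by rw [h] at hf3; linarith
  have hA : ∀ x, e.1.1 ≤ x → f.1.1 ≤ x → x < w.1 → segHeight b x < segHeight f x → False := by
    intro x hx1 hx2 hx3 hx4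
    obtain ⟨y, hy1, hy2, hy3⟩ := exists_segHeight_eq b f hx3 hx4 (by linarith)
    exact hE b hbE f hf hfb.symm ⟨y, by linarith, by linarith, by linarith, by linarith, hy3⟩
  have hB : ∀ x, e.1.1 ≤ x → f.1.1 ≤ x → x < w.1 → segHeight f x < segHeight e x → False := by
    intro x hx1 hx2 hx3 hx4
    obtain ⟨y, hy1, hy2, hy3⟩ := exists_segHeight_eq f e hx3 hx4 (by linarith)
    exact hE f hf e he hfe.symm ⟨y, by linarith, by linarith, by linarith, by linarith, hy3⟩
  have hev : segHeight e e.1.1 = segHeight b e.1.1 := by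
    conv_rhs => rw [← hbe1, segHeight_left, hbe]
    rw [segHeight_left]
  rcases lt_trichotomy f.1.1 e.1.1 with h | h | h
  · rcases lt_trichotomy (segHeight f e.1.1) (segHeight e e.1.1) with h' | h' | h'
    · exact hB _ le_rfl h.le hw1 h'
    · exact hG.avoid f hf e.1 (hG.left_mem e he) h (by linarith) (by rw [h', segHeight_left])
    · exact hA _ le_rfl h.le hw1 (by rwa [← hev])
  · have hfe1 : f.1 = e.1 := hG.inj _ (hG.left_mem f hf) _ (hG.left_mem e he) h
    have hs : ∀ g : (ℝ × ℝ) × (ℝ × ℝ), g.1 = e.1 → segHeight g w.1 =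
      e.1.2 + segSlope g * (w.1 - e.1.1) := fun g hg => by simp only [segHeight, hg]
    have h1 : segSlope e < segSlope f := by
      rw [hs e rfl, hs f hfe1] at hcon
      exact lt_of_mul_lt_mul_right (by linarith) (sub_pos.2 hw1).le
    have h2 : segSlope f < segSlope b := by
      have := lt_of_lt_of_le hf3 hw5
      rw [hs b hbe, hs f hfe1] at this
      exact lt_of_mul_lt_mul_right (by linarith) (sub_pos.2 hw1).le
    have := hbmin f (Finset.mem_filter.2 ⟨hf, hfe1, h1⟩)
    linarith
  · rcases lt_trichotomy (segHeight e f.1.1) f.1.2 with h' | h' | h'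
    · rcases le_or_gt f.1.2 (segHeight b f.1.1) with h'' | h''
      · have := hwmin f.1 (Finset.mem_filter.2
          ⟨hG.left_mem f hf, h, by linarith, by linarith, h', h''⟩)
        linarith
      · exact hA _ h.le le_rfl hf1 (by rwa [segHeight_left f])
    · exact hG.avoid e he f.1 (hG.left_mem f hf) h (by linarith) h'
    · exact hB _ h.le le_rfl hf1 (by rwa [segHeight_left f])

/-- A charging argument in place of Euler's formula: each edge is the steepest one leaving its left
end, the least steep one entering its right end, or the first one below some vertex. Each role gives
a vertex at most one edge. -/
theorem IsGeomGraph.card_le_of_noncrossing {V : Finset (ℝ × ℝ)} {E : Finset ((ℝ × ℝ) × (ℝ × ℝ))}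
    (hG : IsGeomGraph V E) (hE : ∀ e ∈ E, ∀ f ∈ E, e ≠ f → ¬ SegCross e f) :
    E.card ≤ 3 * V.card := by
  classical
  set T₁ := E.filter fun e => ∀ f ∈ E, f.1 = e.1 → segSlope f ≤ segSlope e
  set T₂ := E.filter fun e => ∀ f ∈ E, f.2 = e.2 → segSlope e ≤ segSlope f
  set T₃ := E.filter fun e => ∃ w ∈ V, DirectlyBelow E w e
  have hsub : E ⊆ T₁ ∪ T₂ ∪ T₃ := by
    intro e he
    by_contra hcon
    simp only [Finset.mem_union, not_or, T₁, T₂, T₃, Finset.mem_filter, he, true_and] at hcon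
    obtain ⟨⟨h1, h2⟩, h3⟩ := hcon
    push Not at h1 h2
    exact h3 (hG.exists_directlyBelow hE he h1 h2)
  have h₁ : T₁.card ≤ V.card := by
    refine Finset.card_le_card_of_injOn Prod.fst
      (fun e he => hG.left_mem e (Finset.mem_filter.1 he).1) ?_
    intro e he f hf hef
    obtain ⟨heE, he⟩ := Finset.mem_filter.1 he
    obtain ⟨hfE, hf⟩ := Finset.mem_filter.1 hf
    have hs := le_antisymm (hf e heE hef) (he f hfE hef.symm)
    by_contra hne
    have h1 := hG.lt e heE
    have h2 := hG.lt f hfE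
    have hef1 : e.1.1 = f.1.1 := by rw [hef]
    obtain ⟨x, hx1, hx2⟩ := exists_between (lt_min h1 (hef1 ▸ h2))
    rw [lt_min_iff] at hx2
    exact hE e heE f hfE hne ⟨x, hx1, hx2.1, hef1 ▸ hx1, hx2.2, by simp only [segHeight, hs, hef]⟩
  have h₂ : T₂.card ≤ V.card := by
    refine Finset.card_le_card_of_injOn Prod.snd
      (fun e he => hG.right_mem e (Finset.mem_filter.1 he).1) ?_
    intro e he f hf hef
    obtain ⟨heE, he⟩ := Finset.mem_filter.1 he
    obtain ⟨hfE, hf⟩ := Finset.mem_filter.1 hf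
    have hs := le_antisymm (he f hfE hef.symm) (hf e heE hef)
    by_contra hne
    have h1 := hG.lt e heE
    have h2 := hG.lt f hfE
    have hef1 : e.2.1 = f.2.1 := by rw [hef]
    obtain ⟨x, hx1, hx2⟩ := exists_between (max_lt h1 (hef1.symm ▸ h2))
    rw [max_lt_iff] at hx1
    exact hE e heE f hfE hne ⟨x, hx1.1, hx2, hx1.2, hef1 ▸ hx2, by
      rw [segHeight_eq_right e h1, segHeight_eq_right f h2, hs, hef]⟩
  have h₃ : T₃.card ≤ V.card := by
    have : ∀ e : (ℝ × ℝ) × (ℝ × ℝ), ∃ w, e ∈ T₃ → w ∈ V ∧ DirectlyBelow E w e := by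
      intro e
      by_cases he : e ∈ T₃
      · obtain ⟨w, hw⟩ := (Finset.mem_filter.1 he).2
        exact ⟨w, fun _ => hw⟩
      · exact ⟨0, fun h => absurd h he⟩
    choose w hw using this
    refine Finset.card_le_card_of_injOn w (fun e he => (hw e he).1) ?_
    intro e he f hf hef
    refine DirectlyBelow.unique hE (Finset.mem_filter.1 he).1 (Finset.mem_filter.1 hf).1
      (hw e he).2 ?_
    rw [hef]
    exact (hw f hf).2
  have := Finset.card_le_card hsub
  have h4 := Finset.card_union_le (T₁ ∪ T₂) T₃
  have h5 := Finset.card_union_le T₁ T₂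
  omega

/-! ### The crossing lemma -/

open Classical in
/-- The ordered pairs of distinct crossing edges. -/
noncomputable def crossPairs (E : Finset ((ℝ × ℝ) × (ℝ × ℝ))) :
    Finset (((ℝ × ℝ) × (ℝ × ℝ)) × ((ℝ × ℝ) × (ℝ × ℝ))) :=
  (E ×ˢ E).filter fun x => x.1 ≠ x.2 ∧ SegCross x.1 x.2

/-- Deleting the first edge of every crossing pair leaves a graph without crossings. -/
theorem IsGeomGraph.card_le_add_crossPairs {V : Finset (ℝ × ℝ)}
    {E : Finset ((ℝ × ℝ) × (ℝ × ℝ))} (hG : IsGeomGraph V E) :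
    E.card ≤ 3 * V.card + (crossPairs E).card := by
  classical
  set E' := E \ (crossPairs E).image Prod.fst
  have hE' : E' ⊆ E := Finset.sdiff_subset
  have h1 : E'.card ≤ 3 * V.card := by
    refine IsGeomGraph.card_le_of_noncrossing ⟨hG.inj, fun e he => hG.left_mem e (hE' he),
      fun e he => hG.right_mem e (hE' he), fun e he => hG.lt e (hE' he),
      fun e he => hG.avoid e (hE' he)⟩ ?_
    intro e he f hf hne hc
    refine (Finset.mem_sdiff.1 he).2 (Finset.mem_image.2 ⟨(e, f), ?_, rfl⟩)
    exact Finset.mem_filter.2 ⟨Finset.mk_mem_product (hE' he) (hE' hf), hne, hc⟩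
  have h2 : E.card ≤ E'.card + ((crossPairs E).image Prod.fst).card := by
    rw [add_comm]; exact Finset.card_le_card_sdiff_add_card.trans (by rw [add_comm])
  have h3 : ((crossPairs E).image Prod.fst).card ≤ (crossPairs E).card := Finset.card_image_le
  omega

/-- The probability that a random subset, keeping each point with probability `p`, contains `T`. The
choices outside `T` have total weight one by the binomial theorem. -/
theorem sum_powerset_weight {α : Type*} [DecidableEq α] {P T : Finset α} (hT : T ⊆ P) (p : ℝ) :
    ∑ S ∈ P.powerset with T ⊆ S, p ^ S.card * (1 - p) ^ (P.card - S.card) = p ^ T.card := by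
  have h := Finset.sum_pow_mul_eq_add_pow p (1 - p) (P \ T)
  rw [add_sub_cancel, one_pow] at h
  have hc : (P \ T).card = P.card - T.card := Finset.card_sdiff_of_subset hT
  calc _ = ∑ S ∈ (P \ T).powerset, p ^ T.card *
        (p ^ S.card * (1 - p) ^ ((P \ T).card - S.card)) := by
        refine Finset.sum_nbij' (fun S => S \ T) (fun S => S ∪ T) ?_ ?_ ?_ ?_ ?_
        · intro S hS
          simp only [Finset.mem_filter, Finset.mem_powerset] at hS ⊢
          exact Finset.sdiff_subset_sdiff hS.1 le_rfl
        · intro S hS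
          simp only [Finset.mem_filter, Finset.mem_powerset] at hS ⊢
          exact ⟨Finset.union_subset (hS.trans Finset.sdiff_subset) hT,
            Finset.subset_union_right⟩
        · intro S hS
          simp only [Finset.mem_filter, Finset.mem_powerset] at hS
          exact Finset.sdiff_union_of_subset hS.2
        · intro S hS
          rw [Finset.mem_powerset] at hS
          rw [Finset.union_sdiff_right, Finset.sdiff_eq_self_iff_disjoint]
          exact Finset.disjoint_of_subset_left hS Finset.sdiff_disjoint
        · intro S hS
          simp only [Finset.mem_filter, Finset.mem_powerset] at hS
          have h1 : (S \ T).card = S.card - T.card := Finset.card_sdiff_of_subset hS.2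
          have h2 := Finset.card_le_card hS.2
          have h3 := Finset.card_le_card hS.1
          rw [← mul_assoc, ← pow_add, h1, hc]
          congr 2 <;> omega
    _ = p ^ T.card := by rw [← Finset.mul_sum, h, mul_one]

theorem sum_powerset_weight_mul_card {α ι : Type*} [DecidableEq α] {P : Finset α} {I : Finset ι}
    {T : ι → Finset α} {t : ℕ} (hT : ∀ i ∈ I, T i ⊆ P) (ht : ∀ i ∈ I, (T i).card = t) (p : ℝ) :
    ∑ S ∈ P.powerset, p ^ S.card * (1 - p) ^ (P.card - S.card) *
      ((I.filter fun i => T i ⊆ S).card : ℝ) = I.card * p ^ t := by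
  simp_rw [Finset.card_filter, Nat.cast_sum, Finset.mul_sum]
  rw [Finset.sum_comm]
  have : ∀ i ∈ I, ∑ S ∈ P.powerset, p ^ S.card * (1 - p) ^ (P.card - S.card) *
      (((if T i ⊆ S then 1 else 0 : ℕ)) : ℝ) = p ^ t := by
    intro i hi
    rw [← ht i hi, ← sum_powerset_weight (hT i hi) p, Finset.sum_filter]
    refine Finset.sum_congr rfl fun S _ => ?_
    split_ifs <;> simp
  rw [Finset.sum_congr rfl this]
  simp

/-- Edges with a common left (or right) end and a further common point are collinear, so they
coincide or one has a vertex in its interior. A crossing thus involves four vertices and survives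
sampling with probability exactly `p ^ 4`. -/
theorem IsGeomGraph.endpoints_ne {V : Finset (ℝ × ℝ)} {E : Finset ((ℝ × ℝ) × (ℝ × ℝ))}
    (hG : IsGeomGraph V E) {e f : (ℝ × ℝ) × (ℝ × ℝ)} (he : e ∈ E) (hf : f ∈ E) (hne : e ≠ f)
    (hc : SegCross e f) : e.1 ≠ f.1 ∧ e.1 ≠ f.2 ∧ e.2 ≠ f.1 ∧ e.2 ≠ f.2 := by
  obtain ⟨x, h1, h2, h3, h4, h5⟩ := hc
  have hel := hG.lt e he
  have hfl := hG.lt f hf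
  refine ⟨fun h => ?_, fun h => ?_, fun h => ?_, fun h => ?_⟩
  · have hs : segSlope e = segSlope f := by
      simp only [segHeight, h] at h5
      rw [add_right_inj] at h5
      exact mul_right_cancel₀ (by linarith) h5
    have hh : ∀ y, segHeight e y = segHeight f y := fun y => by simp only [segHeight, h, hs]
    have h' : e.1.1 = f.1.1 := by rw [h]
    rcases lt_trichotomy e.2.1 f.2.1 with hlt | heq | hgt
    · exact hG.avoid f hf e.2 (hG.right_mem e he) (by linarith) hlt
        (by rw [← hh, segHeight_right e hel])
    · exact hne (Prod.ext h (hG.inj _ (hG.right_mem e he) _ (hG.right_mem f hf) heq))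
    · exact hG.avoid e he f.2 (hG.right_mem f hf) (by linarith) hgt
        (by rw [hh, segHeight_right f hfl])
  · rw [h] at h1; linarith
  · rw [h] at h2; linarith
  · have hs : segSlope e = segSlope f := by
      rw [segHeight_eq_right e hel, segHeight_eq_right f hfl, h, sub_right_inj] at h5
      rw [h] at h2
      exact mul_right_cancel₀ (by linarith) h5
    have hh : ∀ y, segHeight e y = segHeight f y := fun y => by
      rw [segHeight_eq_right e hel, segHeight_eq_right f hfl, h, hs]
    have h' : e.2.1 = f.2.1 := by rw [h]
    rcases lt_trichotomy e.1.1 f.1.1 with hlt | heq | hgt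
    · exact hG.avoid e he f.1 (hG.left_mem f hf) hlt (by linarith)
        (by rw [hh, segHeight_left])
    · exact hne (Prod.ext (hG.inj _ (hG.left_mem e he) _ (hG.left_mem f hf) heq) h)
    · exact hG.avoid f hf e.1 (hG.left_mem e he) hgt (by linarith)
        (by rw [← hh, segHeight_left])

/-- The crossing lemma, in the form given by sampling the vertices with probability `p`. -/
theorem IsGeomGraph.card_mul_sq_le {V : Finset (ℝ × ℝ)} {E : Finset ((ℝ × ℝ) × (ℝ × ℝ))}
    (hG : IsGeomGraph V E) {p : ℝ} (hp0 : 0 ≤ p) (hp1 : p ≤ 1) :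
    E.card * p ^ 2 ≤ 3 * V.card * p + (crossPairs E).card * p ^ 4 := by
  classical
  -- The weak bound for the subgraph induced on `S`, multiplied by the probability of `S`; summing
  -- over `S` takes expectations.
  have key : ∀ S ∈ V.powerset, p ^ S.card * (1 - p) ^ (V.card - S.card) *
      ((E.filter fun e => ({e.1, e.2} : Finset (ℝ × ℝ)) ⊆ S).card : ℝ) ≤
      3 * (p ^ S.card * (1 - p) ^ (V.card - S.card) *
        ((V.filter fun v => ({v} : Finset (ℝ × ℝ)) ⊆ S).card : ℝ)) +
      p ^ S.card * (1 - p) ^ (V.card - S.card) * (((crossPairs E).filter fun x =>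
        ({x.1.1, x.1.2, x.2.1, x.2.2} : Finset (ℝ × ℝ)) ⊆ S).card : ℝ) := by
    intro S hS
    rw [Finset.mem_powerset] at hS
    set E' := E.filter fun e => ({e.1, e.2} : Finset (ℝ × ℝ)) ⊆ S with hE'
    have hmem : ∀ e, e ∈ E' ↔ e ∈ E ∧ e.1 ∈ S ∧ e.2 ∈ S := fun e => by
      simp [hE', Finset.insert_subset_iff]
    have hG' : IsGeomGraph S E' :=
      ⟨fun v hv w hw => hG.inj v (hS hv) w (hS hw), fun e he => ((hmem e).1 he).2.1,
        fun e he => ((hmem e).1 he).2.2, fun e he => hG.lt e ((hmem e).1 he).1,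
        fun e he w hw => hG.avoid e ((hmem e).1 he).1 w (hS hw)⟩
    have h1 := hG'.card_le_add_crossPairs
    have h2 : S ⊆ V.filter fun v => ({v} : Finset (ℝ × ℝ)) ⊆ S := fun v hv =>
      Finset.mem_filter.2 ⟨hS hv, by simpa using hv⟩
    have h3 : crossPairs E' ⊆ (crossPairs E).filter fun x =>
        ({x.1.1, x.1.2, x.2.1, x.2.2} : Finset (ℝ × ℝ)) ⊆ S := by
      intro x hx
      simp only [crossPairs, Finset.mem_filter, Finset.mem_product, hmem,
        Finset.insert_subset_iff, Finset.singleton_subset_iff] at hx ⊢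
      tauto
    have h4 := Finset.card_le_card h2
    have h5 := Finset.card_le_card h3
    have h6 : (E'.card : ℝ) ≤ 3 * ((V.filter fun v => ({v} : Finset (ℝ × ℝ)) ⊆ S).card : ℝ) +
        (((crossPairs E).filter fun x =>
          ({x.1.1, x.1.2, x.2.1, x.2.2} : Finset (ℝ × ℝ)) ⊆ S).card : ℝ) := by
      exact_mod_cast h1.trans (by omega)
    have hw : 0 ≤ p ^ S.card * (1 - p) ^ (V.card - S.card) :=
      mul_nonneg (pow_nonneg hp0 _) (pow_nonneg (by linarith) _)
    have := mul_le_mul_of_nonneg_left h6 hw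
    linarith
  have hsum := Finset.sum_le_sum key
  rw [Finset.sum_add_distrib, ← Finset.mul_sum] at hsum
  rw [sum_powerset_weight_mul_card (t := 2), sum_powerset_weight_mul_card (t := 1),
    sum_powerset_weight_mul_card (t := 4)] at hsum
  · linarith
  · intro x hx
    simp only [crossPairs, Finset.mem_filter, Finset.mem_product] at hx
    simp only [Finset.insert_subset_iff, Finset.singleton_subset_iff]
    exact ⟨hG.left_mem _ hx.1.1, hG.right_mem _ hx.1.1, hG.left_mem _ hx.1.2,
      hG.right_mem _ hx.1.2⟩
  · intro x hx
    simp only [crossPairs, Finset.mem_filter, Finset.mem_product] at hx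
    obtain ⟨h1, h2, h3, h4⟩ := hG.endpoints_ne hx.1.1 hx.1.2 hx.2.1 hx.2.2
    have h5 : x.1.1 ≠ x.1.2 := fun h => by
      have := hG.lt _ hx.1.1; rw [h] at this; exact lt_irrefl _ this
    have h6 : x.2.1 ≠ x.2.2 := fun h => by
      have := hG.lt _ hx.1.2; rw [h] at this; exact lt_irrefl _ this
    rw [Finset.card_insert_of_notMem (by simp [*]), Finset.card_insert_of_notMem (by simp [*]),
      Finset.card_pair h6]
  · intro v hv; simpa using hv
  · intro v _; simp
  · intro e he
    simp only [Finset.insert_subset_iff, Finset.singleton_subset_iff]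
    exact ⟨hG.left_mem _ he, hG.right_mem _ he⟩
  · intro e he
    exact Finset.card_pair fun h => by
      have := hG.lt _ he; rw [h] at this; exact lt_irrefl _ this

/-! ### The Szemerédi–Trotter bound in the plane -/

open Classical in
/-- The segments that join consecutive points of `V` on the line `y = l.1 * x + l.2`. -/
noncomputable def lineEdges (V : Finset (ℝ × ℝ)) (l : ℝ × ℝ) : Finset ((ℝ × ℝ) × (ℝ × ℝ)) :=
  (V ×ˢ V).filter fun e => e.1.1 < e.2.1 ∧ e.1.2 = l.1 * e.1.1 + l.2 ∧
    e.2.2 = l.1 * e.2.1 + l.2 ∧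
    ∀ r ∈ V, r.2 = l.1 * r.1 + l.2 → e.1.1 < r.1 → e.2.1 ≤ r.1

/-- Slope and intercept of the line that carries a segment. -/
noncomputable def lineOfSeg (e : (ℝ × ℝ) × (ℝ × ℝ)) : ℝ × ℝ :=
  (segSlope e, e.1.2 - segSlope e * e.1.1)

theorem lineOfSeg_eq {e : (ℝ × ℝ) × (ℝ × ℝ)} {l : ℝ × ℝ} (h : e.1.1 ≠ e.2.1)
    (h₁ : e.1.2 = l.1 * e.1.1 + l.2) (h₂ : e.2.2 = l.1 * e.2.1 + l.2) : lineOfSeg e = l := by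
  have hs : segSlope e = l.1 := by
    have : e.2.1 - e.1.1 ≠ 0 := fun h' => h (by linarith)
    unfold segSlope
    rw [h₁, h₂]
    field_simp
    ring
  ext
  · exact hs
  · simp only [lineOfSeg, hs, h₁]; ring

theorem segHeight_eq_lineOfSeg (e : (ℝ × ℝ) × (ℝ × ℝ)) (x : ℝ) :
    segHeight e x = (lineOfSeg e).1 * x + (lineOfSeg e).2 := by
  simp only [segHeight, lineOfSeg]; ring

theorem lineOfSeg_of_mem {V : Finset (ℝ × ℝ)} {l : ℝ × ℝ} {e : (ℝ × ℝ) × (ℝ × ℝ)}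
    (he : e ∈ lineEdges V l) : lineOfSeg e = l := by
  obtain ⟨-, h1, h2, h3, -⟩ := Finset.mem_filter.1 he
  exact lineOfSeg_eq h1.ne h2 h3

theorem eq_of_mem_lineEdges {V : Finset (ℝ × ℝ)} (hV : Set.InjOn Prod.fst (V : Set (ℝ × ℝ)))
    {l : ℝ × ℝ} {e f : (ℝ × ℝ) × (ℝ × ℝ)} (he : e ∈ lineEdges V l) (hf : f ∈ lineEdges V l)
    {x : ℝ} (h₁ : e.1.1 < x) (h₂ : x < e.2.1) (h₃ : f.1.1 < x) (h₄ : x < f.2.1) : e = f := by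
  obtain ⟨heV, he1, he2, he3, he4⟩ := Finset.mem_filter.1 he
  obtain ⟨hfV, hf1, hf2, hf3, hf4⟩ := Finset.mem_filter.1 hf
  rw [Finset.mem_product] at heV hfV
  have h5 := he4 _ hfV.1 hf2
  have h6 := he4 _ hfV.2 hf3
  have h7 := hf4 _ heV.1 he2
  have h8 := hf4 _ heV.2 he3
  refine Prod.ext (hV heV.1 hfV.1 ?_) (hV heV.2 hfV.2 ?_)
  · rcases lt_trichotomy e.1.1 f.1.1 with h | h | h
    · linarith [h5 h]
    · exact h
    · linarith [h7 h]
  · exact le_antisymm (h6 (by linarith)) (h8 (by linarith))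

/-- Every point on the line except the rightmost starts an edge. -/
theorem card_le_card_lineEdges {V : Finset (ℝ × ℝ)} {l : ℝ × ℝ} :
    (V.filter fun r => r.2 = l.1 * r.1 + l.2).card ≤ (lineEdges V l).card + 1 := by
  classical
  set Q := V.filter fun r => r.2 = l.1 * r.1 + l.2 with hQ
  rcases Q.eq_empty_or_nonempty with h | h
  · simp [h]
  obtain ⟨m, hm, hmax⟩ := Finset.exists_max_image Q Prod.fst h
  have hQmem : ∀ r, r ∈ Q ↔ r ∈ V ∧ r.2 = l.1 * r.1 + l.2 := fun r => Finset.mem_filter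
  have hinj : ∀ r ∈ Q, ∀ s ∈ Q, r.1 = s.1 → r = s := fun r hr s hs h =>
    Prod.ext h (by rw [((hQmem r).1 hr).2, ((hQmem s).1 hs).2, h])
  have : ∀ p : ℝ × ℝ, ∃ q, p ∈ Q.erase m → (p, q) ∈ lineEdges V l := by
    intro p
    by_cases hp : p ∈ Q.erase m
    · obtain ⟨hpm, hpQ⟩ := Finset.mem_erase.1 hp
      have hlt : p.1 < m.1 := lt_of_le_of_ne (hmax p hpQ) fun h => hpm (hinj _ hpQ _ hm h)
      obtain ⟨q, hq, hqmin⟩ := Finset.exists_min_image (Q.filter fun r => p.1 < r.1) Prod.fst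
        ⟨m, Finset.mem_filter.2 ⟨hm, hlt⟩⟩
      obtain ⟨hqQ, hpq⟩ := Finset.mem_filter.1 hq
      refine ⟨q, fun _ => Finset.mem_filter.2 ⟨Finset.mk_mem_product ((hQmem p).1 hpQ).1
        ((hQmem q).1 hqQ).1, hpq, ((hQmem p).1 hpQ).2, ((hQmem q).1 hqQ).2, fun r hr hrl hpr =>
        hqmin r (Finset.mem_filter.2 ⟨(hQmem r).2 ⟨hr, hrl⟩, hpr⟩)⟩⟩
    · exact ⟨0, fun h => absurd h hp⟩
  choose s hs using this
  have hcard : (Q.erase m).card ≤ (lineEdges V l).card :=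
    Finset.card_le_card_of_injOn (fun p => (p, s p)) (fun p hp => hs p hp)
      fun p _ q _ hpq => (Prod.ext_iff.1 hpq).1
  have := Finset.card_erase_add_one hm
  omega

/-- The choice `p ^ 2 = k / (2 * M)` makes the crossing term half of the left side. It is a
probability only when `k ≤ 2 * M`; otherwise `p = 1` suffices and produces the second term. -/
theorem rich_lines_arith {M n k : ℝ} (hM : 0 ≤ M) (hn : 0 ≤ n) (hk : 0 < k)
    (h : ∀ p : ℝ, 0 ≤ p → p ≤ 1 → k * M * p ^ 2 ≤ 3 * n * p + M ^ 2 * p ^ 4) :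
    M * k ^ 3 ≤ 72 * n ^ 2 + 6 * n * k ^ 2 := by
  rcases hM.eq_or_lt with rfl | hM
  · simp only [zero_mul]; positivity
  rcases le_or_gt k (2 * M) with hkM | hkM
  · set p := Real.sqrt (k / (2 * M)) with hp
    have hp2 : p ^ 2 = k / (2 * M) := Real.sq_sqrt (by positivity)
    have hp0 : 0 < p := Real.sqrt_pos.2 (by positivity)
    have hp1 : p ≤ 1 := Real.sqrt_le_one.2 ((div_le_one (by positivity)).2 hkM)
    have h1 := h p hp0.le hp1
    have h2 : M * p ^ 2 = k / 2 := by rw [hp2]; field_simp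
    have h3 : M ^ 2 * p ^ 4 = k / 2 * (M * p ^ 2) := by rw [← h2]; ring
    have h4 : k * M * p * p ≤ 6 * n * p := by nlinarith
    have h5 : k * M * p ≤ 6 * n := le_of_mul_le_mul_right h4 hp0
    have h6 : (k * M * p) ^ 2 ≤ (6 * n) ^ 2 := pow_le_pow_left₀ (by positivity) h5 2
    have h7 : (k * M * p) ^ 2 = k ^ 2 * M * (M * p ^ 2) := by ring
    rw [h7, h2] at h6
    have : 0 ≤ n * k ^ 2 := by positivity
    nlinarith
  · have h1 := h 1 zero_le_one le_rfl
    have h2 : M * M ≤ M * (k / 2) := by gcongr; linarith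
    have h3 : M * k ≤ 6 * n := by nlinarith
    have h4 : M * k * k ^ 2 ≤ 6 * n * k ^ 2 := by gcongr
    nlinarith [sq_nonneg n]

/-- The Szemerédi–Trotter bound on rich lines. -/
theorem card_rich_lines_le {V L : Finset (ℝ × ℝ)} (hV : Set.InjOn Prod.fst (V : Set (ℝ × ℝ)))
    {k : ℕ} (hk : 0 < k)
    (hL : ∀ l ∈ L, k + 1 ≤ (V.filter fun r => r.2 = l.1 * r.1 + l.2).card) :
    (L.card : ℝ) * (k : ℝ) ^ 3 ≤ 72 * (V.card : ℝ) ^ 2 + 6 * V.card * (k : ℝ) ^ 2 := by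
  classical
  set E := L.biUnion (lineEdges V) with hE
  have hmem : ∀ e ∈ E, lineOfSeg e ∈ L ∧ e ∈ lineEdges V (lineOfSeg e) := by
    intro e he
    obtain ⟨l, hl, hel⟩ := Finset.mem_biUnion.1 he
    rw [lineOfSeg_of_mem hel]
    exact ⟨hl, hel⟩
  have hG : IsGeomGraph V E := by
    refine ⟨fun v hv w hw h => hV hv hw h, ?_, ?_, ?_, ?_⟩
    · exact fun e he => (Finset.mem_product.1 (Finset.mem_filter.1 (hmem e he).2).1).1
    · exact fun e he => (Finset.mem_product.1 (Finset.mem_filter.1 (hmem e he).2).1).2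
    · exact fun e he => (Finset.mem_filter.1 (hmem e he).2).2.1
    · intro e he w hw h1 h2 h3
      have := (Finset.mem_filter.1 (hmem e he).2).2.2.2.2 w hw
        (by rw [← h3, segHeight_eq_lineOfSeg]) h1
      linarith
  have hEcard : k * L.card ≤ E.card := by
    rw [hE, Finset.card_biUnion]
    · rw [mul_comm, ← smul_eq_mul]
      refine Finset.card_nsmul_le_sum _ _ _ fun l hl => ?_
      have h1 := hL l hl
      have h2 := card_le_card_lineEdges (V := V) (l := l)
      omega
    · intro l _ l' _ hne
      rw [Function.onFun, Finset.disjoint_left]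
      intro e he he'
      exact hne ((lineOfSeg_of_mem he).symm.trans (lineOfSeg_of_mem he'))
  -- Crossing edges lie on distinct lines, which meet in one point, and that point lies inside only
  -- one edge of each line.
  have hX : (crossPairs E).card ≤ L.card * L.card := by
    rw [← Finset.card_product]
    have hX : ∀ x ∈ crossPairs E, (x.1 ∈ E ∧ x.2 ∈ E) ∧ x.1 ≠ x.2 ∧ SegCross x.1 x.2 := by
      intro x hx
      rw [← Finset.mem_product]
      exact Finset.mem_filter.1 hx
    refine Finset.card_le_card_of_injOn (fun x => (lineOfSeg x.1, lineOfSeg x.2)) ?_ ?_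
    · intro x hx
      exact Finset.mk_mem_product (hmem _ (hX x hx).1.1).1 (hmem _ (hX x hx).1.2).1
    · rintro ⟨e, f⟩ hx ⟨e', f'⟩ hx' heq
      obtain ⟨⟨he, hf⟩, hne, x, hx1, hx2, hx3, hx4, hx5⟩ := hX _ hx
      obtain ⟨⟨he', hf'⟩, hne', x', hx1', hx2', hx3', hx4', hx5'⟩ := hX _ hx'
      obtain ⟨hl1, hl2⟩ := Prod.ext_iff.1 heq
      simp only at he hf hne hx1 hx2 hx3 hx4 hx5 he' hf' hne' hx1' hx2' hx3' hx4' hx5' hl1 hl2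
      have hee := (hmem e he).2
      have hff := (hmem f hf).2
      have hee' := (hmem e' he').2
      have hff' := (hmem f' hf').2
      rw [← hl1] at hee'
      rw [← hl2] at hff'
      rw [segHeight_eq_lineOfSeg, segHeight_eq_lineOfSeg] at hx5 hx5'
      rw [← hl1, ← hl2] at hx5'
      have hll : lineOfSeg e ≠ lineOfSeg f := fun h => by
        rw [h] at hee
        exact hne (eq_of_mem_lineEdges hV hee hff hx1 hx2 hx3 hx4)
      have hxx : x = x' := by
        have h1 : ((lineOfSeg e).1 - (lineOfSeg f).1) * (x - x') = 0 := by linarith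
        rcases mul_eq_zero.1 h1 with h | h
        · exact absurd (Prod.ext (sub_eq_zero.1 h)
            (by rw [sub_eq_zero.1 h] at hx5; linarith)) hll
        · exact sub_eq_zero.1 h
      subst hxx
      rw [eq_of_mem_lineEdges hV hee hee' hx1 hx2 hx1' hx2',
        eq_of_mem_lineEdges hV hff hff' hx3 hx4 hx3' hx4']
  refine rich_lines_arith (by positivity) (by positivity) (by exact_mod_cast hk) ?_
  intro p hp0 hp1
  have h1 := hG.card_mul_sq_le hp0 hp1
  have h2 : (k : ℝ) * L.card ≤ E.card := by exact_mod_cast hEcard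
  have h3 : ((crossPairs E).card : ℝ) ≤ (L.card : ℝ) ^ 2 := by
    rw [sq]; exact_mod_cast hX
  calc (k : ℝ) * L.card * p ^ 2 ≤ E.card * p ^ 2 := by gcongr
    _ ≤ _ := h1
    _ ≤ _ := by gcongr

/-! ### Rich lines in a vector space, and the pairs spanning them -/

theorem exists_dual_ne_zero {V : Type*} [AddCommGroup V] [Module ℝ V] {T : Set V}
    (hT : T.Finite) : ∃ f : Module.Dual ℝ V, ∀ v ∈ T, v ≠ 0 → f v ≠ 0 := by
  have : Finite {v : V // v ∈ T ∧ v ≠ 0} := (hT.subset fun v (hv : v ∈ T ∧ v ≠ 0) => hv.1).to_subtype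
  obtain ⟨f, hf⟩ := Module.exists_dual_forall_apply_ne_zero (K := ℝ)
    (fun v : {v : V // v ∈ T ∧ v ≠ 0} => (v : V)) fun v => v.2.2
  exact ⟨f, fun v hv h0 => hf ⟨v, hv, h0⟩⟩

section Lines

variable {V : Type*} [AddCommGroup V] [Module ℝ V]

theorem mem_line_iff {p q r : V} : r ∈ line[ℝ, p, q] ↔ ∃ t : ℝ, r - p = t • (q - p) := by
  rw [mem_affineSpan_pair_iff_exists_lineMap_eq]
  refine exists_congr fun t => ?_
  rw [AffineMap.lineMap_apply_module', eq_comm, sub_eq_iff_eq_add]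

theorem line_eq_of_mem {p q r s : V} (hr : r ∈ line[ℝ, p, q]) (hs : s ∈ line[ℝ, p, q])
    (hrs : r ≠ s) : line[ℝ, r, s] = line[ℝ, p, q] := by
  refine le_antisymm (affineSpan_pair_le_of_mem_of_mem hr hs) ?_
  obtain ⟨a, ha⟩ := mem_line_iff.1 hr
  obtain ⟨b, hb⟩ := mem_line_iff.1 hs
  have hab : b - a ≠ 0 := fun h => hrs <| by
    have : a = b := by linarith
    rw [this, ← hb] at ha
    exact sub_left_inj.1 ha
  have hr' : r = p + a • (q - p) := by rw [← ha]; abel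
  have hs' : s = p + b • (q - p) := by rw [← hb]; abel
  have hsr : s - r = (b - a) • (q - p) := by rw [hr', hs']; module
  have hqp : q - p = (b - a)⁻¹ • (s - r) := by rw [hsr, smul_smul, inv_mul_cancel₀ hab, one_smul]
  refine affineSpan_pair_le_of_mem_of_mem (mem_line_iff.2 ⟨-a * (b - a)⁻¹, ?_⟩)
    (mem_line_iff.2 ⟨(1 - a) * (b - a)⁻¹, ?_⟩)
  · rw [mul_smul, ← hqp, hr']; module
  · rw [mul_smul, ← hqp, hr']; module

theorem eq_of_mem_of_notMem {ℓ : AffineSubspace ℝ V} {a a' b c : V} (ha : a ∈ ℓ) (ha' : a' ∈ ℓ)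
    (hb : b ∉ ℓ) (h : a ∈ line[ℝ, b, c]) (h' : a' ∈ line[ℝ, b, c]) : a = a' := by
  by_contra hne
  have h1 := line_eq_of_mem h h' hne
  have h2 : b ∈ line[ℝ, a, a'] := h1 ▸ left_mem_affineSpan_pair ℝ b c
  exact hb (affineSpan_pair_le_of_mem_of_mem ha ha' h2)

open Classical in
/-- The lines through at least two points of `P`. -/
noncomputable def spannedLines (P : Finset V) : Finset (AffineSubspace ℝ V) :=
  P.offDiag.image fun x => line[ℝ, x.1, x.2]

open Classical in
/-- The points of `P` in the affine subspace `ℓ`. -/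
noncomputable def ptsIn (P : Finset V) (ℓ : AffineSubspace ℝ V) : Finset V :=
  P.filter fun r => r ∈ ℓ

theorem mem_ptsIn {P : Finset V} {ℓ : AffineSubspace ℝ V} {r : V} :
    r ∈ ptsIn P ℓ ↔ r ∈ P ∧ r ∈ ℓ := by
  classical
  exact Finset.mem_filter

theorem ptsIn_subset (P : Finset V) (ℓ : AffineSubspace ℝ V) : ptsIn P ℓ ⊆ P :=
  fun _ h => (mem_ptsIn.1 h).1

theorem mem_spannedLines {P : Finset V} {ℓ : AffineSubspace ℝ V} :
    ℓ ∈ spannedLines P ↔ ∃ p ∈ P, ∃ q ∈ P, p ≠ q ∧ line[ℝ, p, q] = ℓ := by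
  classical
  simp only [spannedLines, Finset.mem_image, Finset.mem_offDiag, Prod.exists]
  constructor
  · rintro ⟨p, q, ⟨hp, hq, hne⟩, h⟩; exact ⟨p, hp, q, hq, hne, h⟩
  · rintro ⟨p, hp, q, hq, hne, h⟩; exact ⟨p, q, ⟨hp, hq, hne⟩, h⟩

theorem line_eq_of_mem_spannedLines {P : Finset V} {ℓ : AffineSubspace ℝ V}
    (hℓ : ℓ ∈ spannedLines P) {r s : V} (hr : r ∈ ℓ) (hs : s ∈ ℓ) (hrs : r ≠ s) :
    line[ℝ, r, s] = ℓ := by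
  obtain ⟨p, -, q, -, -, rfl⟩ := mem_spannedLines.1 hℓ
  exact line_eq_of_mem hr hs hrs

theorem two_le_card_ptsIn {P : Finset V} {p q : V} (hp : p ∈ P) (hq : q ∈ P) (hpq : p ≠ q) :
    2 ≤ (ptsIn P line[ℝ, p, q]).card :=
  Finset.one_lt_card.2 ⟨p, mem_ptsIn.2 ⟨hp, left_mem_affineSpan_pair ℝ p q⟩, q,
    mem_ptsIn.2 ⟨hq, right_mem_affineSpan_pair ℝ p q⟩, hpq⟩

/-- The Szemerédi–Trotter bound on rich lines, in a real vector space. -/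
theorem card_rich_spannedLines_le {P : Finset V} {L : Finset (AffineSubspace ℝ V)}
    (hLP : L ⊆ spannedLines P) {k : ℕ} (hk : 0 < k) (hL : ∀ ℓ ∈ L, k + 1 ≤ (ptsIn P ℓ).card) :
    (L.card : ℝ) * (k : ℝ) ^ 3 ≤ 72 * (P.card : ℝ) ^ 2 + 6 * P.card * (k : ℝ) ^ 2 := by
  classical
  obtain ⟨f, hf⟩ := exists_dual_ne_zero
    (((P ×ˢ P).image fun x : V × V => x.2 - x.1).finite_toSet)
  replace hf : ∀ p ∈ P, ∀ q ∈ P, p ≠ q → f q - f p ≠ 0 := fun p hp q hq h => by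
    rw [← map_sub]
    exact hf _ (Finset.mem_coe.2 (Finset.mem_image.2 ⟨(p, q), Finset.mk_mem_product hp hq, rfl⟩))
      (sub_ne_zero.2 h.symm)
  -- For `p ≠ q`, the listed vector vanishes only if the triple is collinear, and `g` of it is the
  -- planar collinearity determinant. So the generic projection `(f, g)` creates no new collinear
  -- triple.
  obtain ⟨g, hg⟩ := exists_dual_ne_zero (((P ×ˢ P ×ˢ P).image fun x : V × V × V =>
    f (x.2.1 - x.1) • (x.2.2 - x.1) - f (x.2.2 - x.1) • (x.2.1 - x.1)).finite_toSet)
  replace hg : ∀ p ∈ P, ∀ q ∈ P, ∀ r ∈ P,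
      (f q - f p) * (g r - g p) = (f r - f p) * (g q - g p) →
      (f q - f p) • (r - p) = (f r - f p) • (q - p) := fun p hp q hq r hr h => by
    by_contra hne
    refine hg _ (Finset.mem_coe.2 (Finset.mem_image.2 ⟨(p, q, r), Finset.mk_mem_product hp
      (Finset.mk_mem_product hq hr), rfl⟩)) ?_ ?_
    · simp only [map_sub]
      exact sub_ne_zero.2 hne
    · simp only [map_sub, map_smul, smul_eq_mul]
      linarith
  set φ : V → ℝ × ℝ := fun v => (f v, g v) with hφ
  have hφinj : Set.InjOn φ (P : Set V) := fun p hp q hq h => by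
    by_contra hne
    exact hf p hp q hq hne (sub_eq_zero.2 (Prod.ext_iff.1 h).1.symm)
  have hline : ∀ p ∈ P, ∀ q ∈ P, p ≠ q → ∀ r ∈ P, (r ∈ line[ℝ, p, q] ↔
      (φ r).2 = (lineOfSeg (φ p, φ q)).1 * (φ r).1 + (lineOfSeg (φ p, φ q)).2) := by
    intro p hp q hq hpq r hr
    have h0 := hf p hp q hq hpq
    have hiff : (φ r).2 = (lineOfSeg (φ p, φ q)).1 * (φ r).1 + (lineOfSeg (φ p, φ q)).2 ↔
        (f q - f p) * (g r - g p) = (f r - f p) * (g q - g p) := by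
      simp only [hφ, lineOfSeg, segSlope]
      constructor
      · intro h
        rw [h]; field_simp; ring
      · intro h
        have : g r = g p + (f r - f p) * (g q - g p) / (f q - f p) := by
          rw [← h]; field_simp; ring
        rw [this]; field_simp; ring
    rw [hiff, mem_line_iff]
    constructor
    · rintro ⟨t, ht⟩
      rw [← map_sub f r, ← map_sub g r, ht]
      simp only [map_sub, map_smul, smul_eq_mul]
      ring
    · intro h
      refine ⟨(f q - f p)⁻¹ * (f r - f p), ?_⟩
      rw [mul_smul, ← hg p hp q hq r hr h, smul_smul, inv_mul_cancel₀ h0, one_smul]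
  have hrep : ∀ ℓ : AffineSubspace ℝ V, ∃ x : V × V, ℓ ∈ L →
      x.1 ∈ P ∧ x.2 ∈ P ∧ x.1 ≠ x.2 ∧ line[ℝ, x.1, x.2] = ℓ := by
    intro ℓ
    by_cases hℓ : ℓ ∈ L
    · obtain ⟨p, hp, q, hq, hpq, h⟩ := mem_spannedLines.1 (hLP hℓ)
      exact ⟨(p, q), fun _ => ⟨hp, hq, hpq, h⟩⟩
    · exact ⟨0, fun h => absurd h hℓ⟩
  choose x hx using hrep
  set ψ : AffineSubspace ℝ V → ℝ × ℝ := fun ℓ => lineOfSeg (φ (x ℓ).1, φ (x ℓ).2) with hψ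
  have hmem : ∀ ℓ ∈ L, ∀ r ∈ P, (r ∈ ℓ ↔ (φ r).2 = (ψ ℓ).1 * (φ r).1 + (ψ ℓ).2) := by
    intro ℓ hℓ r hr
    obtain ⟨h1, h2, h3, h4⟩ := hx ℓ hℓ
    rw [← hline _ h1 _ h2 h3 r hr, h4]
  have hψinj : Set.InjOn ψ (L : Set (AffineSubspace ℝ V)) := by
    intro ℓ hℓ ℓ' hℓ' h
    obtain ⟨h1, h2, h3, h4⟩ := hx ℓ hℓ
    have ha : ∀ r ∈ P, r ∈ ℓ → r ∈ ℓ' := fun r hr hrl => by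
      rw [hmem ℓ' hℓ' r hr, ← h, ← hmem ℓ hℓ r hr]; exact hrl
    have h5 : (x ℓ).1 ∈ ℓ := h4.le (left_mem_affineSpan_pair ℝ _ _)
    have h6 : (x ℓ).2 ∈ ℓ := h4.le (right_mem_affineSpan_pair ℝ _ _)
    rw [← h4]
    exact line_eq_of_mem_spannedLines (hLP hℓ') (ha _ h1 h5) (ha _ h2 h6) h3
  have hV : Set.InjOn Prod.fst ((P.image φ : Finset (ℝ × ℝ)) : Set (ℝ × ℝ)) := by
    rintro a ha b hb hab
    obtain ⟨p, hp, rfl⟩ := Finset.mem_image.1 (Finset.mem_coe.1 ha)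
    obtain ⟨q, hq, rfl⟩ := Finset.mem_image.1 (Finset.mem_coe.1 hb)
    by_contra hne
    exact hf p hp q hq (fun h => hne (by rw [h])) (sub_eq_zero.2 hab.symm)
  have key := card_rich_lines_le hV hk (L := L.image ψ) (by
    intro l hl
    obtain ⟨ℓ, hℓ, rfl⟩ := Finset.mem_image.1 hl
    refine (hL ℓ hℓ).trans ?_
    refine Finset.card_le_card_of_injOn φ (fun r hr => ?_)
      (hφinj.mono (fun r hr => (mem_ptsIn.1 (Finset.mem_coe.1 hr)).1))
    obtain ⟨hrP, hrl⟩ := mem_ptsIn.1 hr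
    exact Finset.mem_filter.2 ⟨Finset.mem_image_of_mem _ hrP, (hmem ℓ hℓ r hrP).1 hrl⟩)
  rwa [Finset.card_image_of_injOn hψinj, Finset.card_image_of_injOn hφinj] at key

open Classical in
/-- The ordered pairs of distinct points of `P` on a line with at least `A` and at most `B` points
of `P`. -/
noncomputable def pairsBetween (P : Finset V) (A B : ℝ) : Finset (V × V) :=
  P.offDiag.filter fun x => A ≤ (ptsIn P line[ℝ, x.1, x.2]).card ∧
    ((ptsIn P line[ℝ, x.1, x.2]).card : ℝ) ≤ B

/-- With `t = 2 ^ j`, the rich-lines bound allows `72 n² / t³ + 6 n / t` lines, each carrying at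
most `(4 t)²` pairs. -/
theorem card_pairs_dyadic (P : Finset V) (j : ℕ) :
    ((pairsBetween P (2 ^ (j + 1)) (2 ^ (j + 2))).card : ℝ) ≤
      1152 * (P.card : ℝ) ^ 2 / 2 ^ j + 96 * P.card * 2 ^ j := by
  classical
  set Q := pairsBetween P (2 ^ (j + 1)) (2 ^ (j + 2)) with hQ
  have hQmem : ∀ x, x ∈ Q ↔ (x.1 ∈ P ∧ x.2 ∈ P ∧ x.1 ≠ x.2) ∧
      2 ^ (j + 1) ≤ (ptsIn P line[ℝ, x.1, x.2]).card ∧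
      (ptsIn P line[ℝ, x.1, x.2]).card ≤ 2 ^ (j + 2) := by
    intro x
    simp only [hQ, pairsBetween, Finset.mem_filter, Finset.mem_offDiag]
    norm_cast
  set L := Q.image fun x => line[ℝ, x.1, x.2] with hL
  have hLP : L ⊆ spannedLines P := by
    intro ℓ hℓ
    obtain ⟨x, hx, rfl⟩ := Finset.mem_image.1 hℓ
    obtain ⟨⟨h1, h2, h3⟩, -⟩ := (hQmem x).1 hx
    exact mem_spannedLines.2 ⟨_, h1, _, h2, h3, rfl⟩
  have h1 := card_rich_spannedLines_le hLP (k := 2 ^ j) (by positivity) (by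
    intro ℓ hℓ
    obtain ⟨x, hx, rfl⟩ := Finset.mem_image.1 hℓ
    have := ((hQmem x).1 hx).2.1
    have h2 : 1 ≤ 2 ^ j := Nat.one_le_two_pow
    rw [pow_succ] at this
    omega)
  have h2 : Q.card ≤ (2 ^ (j + 2) * 2 ^ (j + 2)) * L.card := by
    refine Finset.card_le_mul_card_image _ _ fun ℓ hℓ => ?_
    obtain ⟨x, hx, rfl⟩ := Finset.mem_image.1 hℓ
    have hb := ((hQmem x).1 hx).2.2
    refine le_trans ?_ (Nat.mul_le_mul hb hb)
    rw [← Finset.card_product]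
    refine Finset.card_le_card fun y hy => ?_
    obtain ⟨hyQ, hyl⟩ := Finset.mem_filter.1 hy
    obtain ⟨⟨h1, h2, h3⟩, -⟩ := (hQmem y).1 hyQ
    rw [← hyl]
    exact Finset.mk_mem_product (mem_ptsIn.2 ⟨h1, left_mem_affineSpan_pair ..⟩)
      (mem_ptsIn.2 ⟨h2, right_mem_affineSpan_pair ..⟩)
  have h3 : (Q.card : ℝ) ≤ (2 ^ (j + 2) * 2 ^ (j + 2)) * L.card := by exact_mod_cast h2
  set t : ℝ := 2 ^ j with ht
  have ht0 : 0 < t := by positivity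
  push_cast at h1
  rw [← ht] at h1
  have h4 : (2 : ℝ) ^ (j + 2) = 4 * t := by rw [pow_add, ht]; ring
  rw [h4] at h3
  refine h3.trans ?_
  have h5 : 4 * t * (4 * t) * (L.card : ℝ) = 16 * (L.card * t ^ 3) / t := by field_simp; ring
  rw [h5]
  calc 16 * (L.card * t ^ 3) / t
      ≤ 16 * (72 * (P.card : ℝ) ^ 2 + 6 * P.card * t ^ 2) / t := by gcongr
    _ = _ := by field_simp; ring

/-- Sums the dyadic estimates: the quadratic terms telescope through `1 / 2 ^ b = 2 * (1 / 2 ^ b - 1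
/ 2 ^ (b + 1))`, and the linear terms are dominated by the last scale. The `- 1` makes the dyadic
ranges half-open, so that the base case is empty. -/
theorem card_pairsBetween_le_pow (P : Finset V) {a b : ℕ} (hab : a ≤ b) :
    ((pairsBetween P (2 ^ (a + 1)) (2 ^ (b + 1) - 1)).card : ℝ) ≤
      2304 * (P.card : ℝ) ^ 2 * (1 / 2 ^ a - 1 / 2 ^ b) + 96 * P.card * 2 ^ b := by
  classical
  induction b, hab using Nat.le_induction with
  | base =>
    have : pairsBetween P (2 ^ (a + 1)) (2 ^ (a + 1) - 1) = ∅ := by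
      refine Finset.eq_empty_of_forall_notMem fun x hx => ?_
      have := (Finset.mem_filter.1 hx).2
      linarith [this.1, this.2]
    rw [this, Finset.card_empty, sub_self]
    simp only [Nat.cast_zero, mul_zero, zero_add]
    positivity
  | succ b _ ih =>
    have hsub : pairsBetween P (2 ^ (a + 1)) (2 ^ (b + 1 + 1) - 1) ⊆
        pairsBetween P (2 ^ (a + 1)) (2 ^ (b + 1) - 1) ∪
          pairsBetween P (2 ^ (b + 1)) (2 ^ (b + 2)) := by
      intro x hx
      obtain ⟨hxP, h1, h2⟩ := Finset.mem_filter.1 hx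
      rcases lt_or_ge (ptsIn P line[ℝ, x.1, x.2]).card (2 ^ (b + 1)) with h | h
      · refine Finset.mem_union_left _ (Finset.mem_filter.2 ⟨hxP, h1, ?_⟩)
        rw [le_sub_iff_add_le]
        exact_mod_cast h
      · refine Finset.mem_union_right _ (Finset.mem_filter.2 ⟨hxP, by exact_mod_cast h, ?_⟩)
        linarith
    have h1 : ((pairsBetween P (2 ^ (a + 1)) (2 ^ (b + 1 + 1) - 1)).card : ℝ) ≤
        (pairsBetween P (2 ^ (a + 1)) (2 ^ (b + 1) - 1)).card +
        (pairsBetween P (2 ^ (b + 1)) (2 ^ (b + 2))).card := by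
      exact_mod_cast (Finset.card_le_card hsub).trans (Finset.card_union_le _ _)
    have h2 := card_pairs_dyadic P b
    have h3 : (2 : ℝ) ^ (b + 1) = 2 * 2 ^ b := by rw [pow_succ]; ring
    have h4 : 2304 * (P.card : ℝ) ^ 2 * (1 / 2 ^ a - 1 / (2 * 2 ^ b)) =
        2304 * (P.card : ℝ) ^ 2 * (1 / 2 ^ a - 1 / 2 ^ b) + 1152 * (P.card : ℝ) ^ 2 / 2 ^ b := by
      field_simp; ring
    rw [h3, h4]
    linarith

theorem card_pairsBetween_le (P : Finset V) (a : ℕ) {B : ℝ} (hB : 0 ≤ B) :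
    ((pairsBetween P (2 ^ (a + 1)) B).card : ℝ) ≤
      2304 * (P.card : ℝ) ^ 2 / 2 ^ a + 96 * P.card * B := by
  rcases lt_or_ge B (2 ^ (a + 1)) with hlt | hge
  · have : pairsBetween P (2 ^ (a + 1)) B = ∅ := by
      refine Finset.eq_empty_of_forall_notMem fun x hx => ?_
      have := (Finset.mem_filter.1 hx).2
      linarith [this.1, this.2]
    rw [this, Finset.card_empty, Nat.cast_zero]
    positivity
  · obtain ⟨b, hb1, hb2⟩ := exists_nat_pow_near
      ((one_le_pow₀ (by norm_num : (1 : ℝ) ≤ 2)).trans hge) (by norm_num : (1 : ℝ) < 2)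
    have hab : a ≤ b := by
      by_contra hcon
      push Not at hcon
      have := pow_le_pow_right₀ (by norm_num : (1 : ℝ) ≤ 2) (show b + 1 ≤ a + 1 by omega)
      linarith
    have hsub : pairsBetween P (2 ^ (a + 1)) B ⊆
        pairsBetween P (2 ^ (a + 1)) (2 ^ (b + 1) - 1) := by
      intro x hx
      obtain ⟨hxP, h1, h2⟩ := Finset.mem_filter.1 hx
      refine Finset.mem_filter.2 ⟨hxP, h1, ?_⟩
      rw [le_sub_iff_add_le]
      exact_mod_cast h2.trans_lt hb2
    have h1 : ((pairsBetween P (2 ^ (a + 1)) B).card : ℝ) ≤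
        (pairsBetween P (2 ^ (a + 1)) (2 ^ (b + 1) - 1)).card := by
      exact_mod_cast Finset.card_le_card hsub
    have h2 := card_pairsBetween_le_pow P hab
    have h3 : 96 * (P.card : ℝ) * 2 ^ b ≤ 96 * P.card * B := by gcongr
    have h4 : 2304 * (P.card : ℝ) ^ 2 * (1 / 2 ^ a - 1 / 2 ^ b) ≤
        2304 * (P.card : ℝ) ^ 2 / 2 ^ a := by
      have : 0 ≤ 2304 * (P.card : ℝ) ^ 2 * (1 / 2 ^ b) := by positivity
      rw [mul_sub, mul_one_div]; linarith
    linarith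

/-- Few pairs of points span a line whose number of points is neither bounded nor linear. -/
theorem exists_card_pairsBetween_le {η : ℝ} (hη : 0 < η) :
    ∃ K : ℕ, 0 < K ∧ ∃ β : ℝ, 0 < β ∧ ∀ P : Finset V,
      ((pairsBetween P K (β * P.card)).card : ℝ) ≤ η * (P.card : ℝ) ^ 2 := by
  obtain ⟨a, ha⟩ := pow_unbounded_of_one_lt (4608 / η) (by norm_num : (1 : ℝ) < 2)
  -- Both error terms become at most half of the target: `2304 / 2 ^ a < η / 2` and `96 * (η / 192)
  -- = η / 2`.
  refine ⟨2 ^ (a + 1), by positivity, η / 192, by positivity, fun P => ?_⟩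
  have h1 := card_pairsBetween_le P a (B := η / 192 * P.card) (by positivity)
  have h2 : 2304 * (P.card : ℝ) ^ 2 / 2 ^ a ≤ η / 2 * (P.card : ℝ) ^ 2 := by
    rw [div_le_iff₀ (by positivity)]
    rw [div_lt_iff₀ hη] at ha
    nlinarith [sq_nonneg (P.card : ℝ)]
  push_cast
  nlinarith

end Lines

/-! ### Beck's theorem -/

section Beck

variable {V : Type*} [AddCommGroup V] [Module ℝ V]

-- A point `t` can block only one `a`, namely the point where the line `bt` meets `ℓ`.
open Classical in
theorem card_blocked_le {ℓ : AffineSubspace ℝ V} {A T : Finset V} (hA : ∀ a ∈ A, a ∈ ℓ) {b : V}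
    (hb : b ∉ ℓ) (hbT : b ∉ T) :
    (A.filter fun a => ∃ t ∈ T, t ∈ line[ℝ, a, b]).card ≤ T.card := by
  have : ∀ a : V, ∃ t, a ∈ (A.filter fun a => ∃ t ∈ T, t ∈ line[ℝ, a, b]) →
      t ∈ T ∧ t ∈ line[ℝ, a, b] := by
    intro a
    by_cases ha : a ∈ (A.filter fun a => ∃ t ∈ T, t ∈ line[ℝ, a, b])
    · obtain ⟨t, ht⟩ := (Finset.mem_filter.1 ha).2
      exact ⟨t, fun _ => ht⟩
    · exact ⟨0, fun h => absurd h ha⟩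
  choose t ht using this
  refine Finset.card_le_card_of_injOn t (fun a ha => (ht a ha).1) ?_
  intro a ha a' ha' heq
  have hmem : ∀ x ∈ (A.filter fun a => ∃ t ∈ T, t ∈ line[ℝ, a, b]), x ∈ line[ℝ, b, t x] := by
    intro x hx
    have hne : b ≠ t x := fun h => hbT (h ▸ (ht x hx).1)
    rw [line_eq_of_mem (right_mem_affineSpan_pair ℝ x b) (ht x hx).2 hne]
    exact left_mem_affineSpan_pair ℝ x b
  refine eq_of_mem_of_notMem (hA _ (Finset.mem_filter.1 ha).1) (hA _ (Finset.mem_filter.1 ha').1)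
    hb (hmem a ha) ?_
  rw [heq]
  exact hmem a' ha'

open Classical in
/-- Many lines join a point set on a line to a smaller one off the line. -/
theorem card_spannedLines_ge_of_line {D A B : Finset V} {ℓ : AffineSubspace ℝ V} (hAD : A ⊆ D)
    (hBD : B ⊆ D) (hA : ∀ a ∈ A, a ∈ ℓ) (hB : ∀ b ∈ B, b ∉ ℓ) :
    B.card * (A.card - B.card) ≤ (spannedLines D).card := by
  -- A joining line with a single point of `B` determines its pair, and each `b` loses at most
  -- `B.card - 1` points of `A` to the rest of `B`.
  set G := (B ×ˢ A).filter fun x => ∀ t ∈ B, t ∈ line[ℝ, x.2, x.1] → t = x.1 with hG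
  have h1 : B.card * (A.card - B.card) ≤ G.card := by
    rw [Finset.card_eq_sum_card_fiberwise (f := Prod.fst) (t := B)
      fun x hx => (Finset.mem_product.1 (Finset.mem_filter.1 hx).1).1, ← smul_eq_mul]
    refine Finset.card_nsmul_le_sum _ _ _ fun b hb => ?_
    have hbad := card_blocked_le (T := B.erase b) hA (hB b hb) (Finset.notMem_erase b B)
    have h2 : A.filter (fun a => ¬ ∃ t ∈ B.erase b, t ∈ line[ℝ, a, b]) ⊆
        (G.filter fun x => x.1 = b).image Prod.snd := by
      intro a ha
      obtain ⟨haA, ha⟩ := Finset.mem_filter.1 ha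
      push Not at ha
      refine Finset.mem_image.2 ⟨(b, a), Finset.mem_filter.2 ⟨Finset.mem_filter.2
        ⟨Finset.mk_mem_product hb haA, fun t ht htl => ?_⟩, rfl⟩, rfl⟩
      by_contra hne
      exact ha t (Finset.mem_erase.2 ⟨hne, ht⟩) htl
    have h3 := (Finset.card_le_card h2).trans Finset.card_image_le
    have h4 := Finset.card_filter_add_card_filter_not (s := A)
      (fun a => ∃ t ∈ B.erase b, t ∈ line[ℝ, a, b])
    have h5 := Finset.card_erase_of_mem hb
    refine le_trans ?_ h3
    omega
  refine h1.trans (Finset.card_le_card_of_injOn (fun x => line[ℝ, x.2, x.1]) ?_ ?_)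
  · rintro ⟨b, a⟩ hx
    obtain ⟨hb, ha⟩ := Finset.mem_product.1 (Finset.mem_filter.1 hx).1
    exact mem_spannedLines.2 ⟨a, hAD ha, b, hBD hb, fun h => hB b hb (h ▸ hA a ha), rfl⟩
  · rintro ⟨b, a⟩ hx ⟨b', a'⟩ hx' heq
    obtain ⟨hxm, hx1⟩ := Finset.mem_filter.1 hx
    obtain ⟨hxm', hx1'⟩ := Finset.mem_filter.1 hx'
    obtain ⟨hb, ha⟩ := Finset.mem_product.1 hxm
    obtain ⟨hb', ha'⟩ := Finset.mem_product.1 hxm'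
    simp only at heq hb ha hb' ha'
    have hbb : b' = b := hx1 b' hb' (heq ▸ right_mem_affineSpan_pair ℝ a' b')
    subst hbb
    have haa : a = a' := by
      rw [Set.pair_comm a, Set.pair_comm a'] at heq
      exact eq_of_mem_of_notMem (hA a ha) (hA a' ha') (hB b' hb)
        (right_mem_affineSpan_pair ℝ b' a) (heq ▸ right_mem_affineSpan_pair ℝ b' a')
    rw [haa]

/-- Beck's theorem. -/
theorem exists_card_spannedLines_ge {ε : ℝ} (hε : 0 < ε) : ∃ c : ℝ, 0 < c ∧ ∀ D : Finset V,
    2 ≤ D.card →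
    (∀ p ∈ D, ∀ q ∈ D, p ≠ q →
      ε * D.card ≤ ((D.card - (ptsIn D line[ℝ, p, q]).card : ℕ) : ℝ)) →
    c * (D.card : ℝ) ^ 2 ≤ (spannedLines D).card := by
  classical
  obtain ⟨K, hK, β, hβ, hpairs⟩ := exists_card_pairsBetween_le (V := V)
    (by norm_num : (0 : ℝ) < 1 / 4)
  have hK' : (0 : ℝ) < K := by exact_mod_cast hK
  refine ⟨min (1 / (4 * (K : ℝ) ^ 2)) (min ε (β / 3) * β / 2), by positivity, fun D hD hoff => ?_⟩
  set N : ℝ := (D.card : ℝ) with hN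
  have hN2 : (2 : ℝ) ≤ N := by rw [hN]; exact_mod_cast hD
  by_cases hrich : ∃ p ∈ D, ∃ q ∈ D, p ≠ q ∧ β * N ≤ (ptsIn D line[ℝ, p, q]).card
  · obtain ⟨p, hp, q, hq, hpq, hr⟩ := hrich
    set A := ptsIn D line[ℝ, p, q] with hA
    have hA2 : 2 ≤ A.card := two_le_card_ptsIn hp hq hpq
    have hAD : A ⊆ D := ptsIn_subset _ _
    have hoffc : (D \ A).card = D.card - A.card := Finset.card_sdiff_of_subset hAD
    have hoff' := hoff p hp q hq hpq
    rw [← hoffc] at hoff'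
    -- Capping `B` at half of `A` keeps `A.card - B.card` linear; rounding down costs at most a
    -- factor giving `β / 3`, since `A` has at least two points.
    obtain ⟨B, hBsub, hBcard⟩ := Finset.exists_subset_card_eq
      (min_le_left (D \ A).card (A.card / 2))
    have h1 := card_spannedLines_ge_of_line (B := B) (ℓ := line[ℝ, p, q]) hAD
      (hBsub.trans Finset.sdiff_subset) (fun a ha => (mem_ptsIn.1 ha).2)
      (fun b hb hbl => (Finset.mem_sdiff.1 (hBsub hb)).2
        (mem_ptsIn.2 ⟨(Finset.mem_sdiff.1 (hBsub hb)).1, hbl⟩))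
    have h2 : B.card ≤ A.card / 2 := hBcard ▸ min_le_right _ _
    have h3 : A.card ≤ 2 * (A.card - B.card) := by omega
    have h3' : (A.card : ℝ) ≤ 2 * ((A.card - B.card : ℕ) : ℝ) := by exact_mod_cast h3
    have h4 : min ε (β / 3) * N ≤ B.card := by
      rw [hBcard, Nat.cast_min, le_min_iff]
      constructor
      · refine le_trans ?_ hoff'
        gcongr
        exact min_le_left _ _
      · have h5 : A.card ≤ 3 * (A.card / 2) := by omega
        have h5' : (A.card : ℝ) ≤ 3 * ((A.card / 2 : ℕ) : ℝ) := by exact_mod_cast h5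
        have : min ε (β / 3) * N ≤ β / 3 * N := by gcongr; exact min_le_right _ _
        linarith
    have h6 : (B.card : ℝ) * ((A.card - B.card : ℕ) : ℝ) ≤ (spannedLines D).card := by
      exact_mod_cast h1
    calc _ ≤ (min ε (β / 3) * β / 2) * N ^ 2 := by gcongr; exact min_le_right _ _
      _ = (min ε (β / 3) * N) * (β * N / 2) := by ring
      _ ≤ B.card * ((A.card - B.card : ℕ) : ℝ) := by
          refine mul_le_mul h4 (by linarith) (by positivity) (by positivity)
      _ ≤ _ := h6
  · push Not at hrich
    set Q := pairsBetween D K (β * N) with hQ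
    have hQc : (Q.card : ℝ) ≤ 1 / 4 * N ^ 2 := hpairs D
    have hQsub : Q ⊆ D.offDiag := Finset.filter_subset _ _
    -- Without rich lines, a pair outside `Q` spans a line with fewer than `K` points. At least `N ^
    -- 2 / 4` pairs remain, because `N ^ 2 - N ≥ N ^ 2 / 2` for `N ≥ 2`.
    have h1 : (D.offDiag \ Q).card ≤ K * K * (spannedLines D).card := by
      have himg : (D.offDiag \ Q).image (fun x => line[ℝ, x.1, x.2]) ⊆ spannedLines D :=
        Finset.image_subset_image Finset.sdiff_subset
      refine (Finset.card_le_mul_card_image _ (K * K) fun ℓ hℓ => ?_).trans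
        (Nat.mul_le_mul_left _ (Finset.card_le_card himg))
      obtain ⟨x, hx, rfl⟩ := Finset.mem_image.1 hℓ
      obtain ⟨hxD, hxQ⟩ := Finset.mem_sdiff.1 hx
      have hxD' := Finset.mem_offDiag.1 hxD
      have hlt : (ptsIn D line[ℝ, x.1, x.2]).card ≤ K := by
        by_contra hcon
        push Not at hcon
        exact hxQ (Finset.mem_filter.2 ⟨hxD, by exact_mod_cast hcon.le,
          (hrich _ hxD'.1 _ hxD'.2.1 hxD'.2.2).le⟩)
      refine le_trans ?_ (Nat.mul_le_mul hlt hlt)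
      rw [← Finset.card_product]
      refine Finset.card_le_card fun y hy => ?_
      obtain ⟨hyD, hyl⟩ := Finset.mem_filter.1 hy
      obtain ⟨h1, h2, -⟩ := Finset.mem_offDiag.1 (Finset.mem_sdiff.1 hyD).1
      rw [← hyl]
      exact Finset.mk_mem_product (mem_ptsIn.2 ⟨h1, left_mem_affineSpan_pair ..⟩)
        (mem_ptsIn.2 ⟨h2, right_mem_affineSpan_pair ..⟩)
    have h2 := Finset.card_sdiff_add_card_eq_card hQsub
    rw [Finset.offDiag_card] at h2
    have h3 : ((D.offDiag \ Q).card : ℝ) + Q.card + N = N * N := by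
      have : (D.offDiag \ Q).card + Q.card + D.card = D.card * D.card := by
        have := Nat.le_mul_self D.card
        omega
      rw [hN]
      exact_mod_cast this
    have h4 : ((D.offDiag \ Q).card : ℝ) ≤ K * K * (spannedLines D).card := by exact_mod_cast h1
    have h5 : N ^ 2 / 4 ≤ (K : ℝ) ^ 2 * (spannedLines D).card := by nlinarith
    calc _ ≤ 1 / (4 * (K : ℝ) ^ 2) * N ^ 2 := by gcongr; exact min_le_left _ _
      _ = N ^ 2 / 4 / (K : ℝ) ^ 2 := by field_simp
      _ ≤ _ := by rw [div_le_iff₀ (by positivity)]; linarith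

end Beck

/-! ### The Sylvester–Gallai theorem, by Kelly's minimal distance argument -/

section SylvesterGallai

variable {V : Type*} [NormedAddCommGroup V] [InnerProductSpace ℝ V]

open scoped RealInnerProductSpace

/-- The squared distance from `r` to the line through `p` and `q`. -/
noncomputable def lineDistSq (r p q : V) : ℝ :=
  ⟪r - p, r - p⟫ - ⟪r - p, q - p⟫ ^ 2 / ⟪q - p, q - p⟫

theorem lineDistSq_eq {h u w : V} (hu : u ≠ 0) (huw : ⟪w, u⟫ = 0) {s t : ℝ} (hst : s ≠ t) :
    lineDistSq (h + w) (h + s • u) (h + t • u) = ⟪w, w⟫ := by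
  have h1 : h + w - (h + s • u) = w - s • u := by abel
  have h2 : h + t • u - (h + s • u) = (t - s) • u := by module
  have hU : ⟪u, u⟫ ≠ 0 := inner_self_ne_zero.2 hu
  have huw' : ⟪u, w⟫ = 0 := by rw [real_inner_comm]; exact huw
  have hts : t - s ≠ 0 := sub_ne_zero.2 hst.symm
  rw [lineDistSq, h1, h2]
  simp only [inner_sub_left, inner_sub_right, inner_smul_left, inner_smul_right, huw, huw',
    RCLike.conj_to_real]
  field_simp
  ring

/-- Kelly's inequality: `h` is the foot of the perpendicular from `h + w`, and `s ^ 2 ≤ s * t` says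
that `h + s • u` lies between the foot and `h + t • u`, possibly at either end. -/
theorem lineDistSq_lt {h u w : V} (hw : w ≠ 0) (huw : ⟪w, u⟫ = 0) {s t : ℝ}
    (hst : s ^ 2 ≤ s * t) : lineDistSq (h + s • u) (h + w) (h + t • u) < ⟪w, w⟫ := by
  have h1 : h + s • u - (h + w) = s • u - w := by abel
  have h2 : h + t • u - (h + w) = t • u - w := by abel
  have hU : 0 ≤ ⟪u, u⟫ := real_inner_self_nonneg
  have hW : 0 < ⟪w, w⟫ := real_inner_self_pos.2 hw
  have huw' : ⟪u, w⟫ = 0 := by rw [real_inner_comm]; exact huw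
  rw [lineDistSq, h1, h2]
  simp only [inner_sub_left, inner_sub_right, inner_smul_left, inner_smul_right, huw, huw',
    RCLike.conj_to_real]
  generalize ⟪u, u⟫ = U at *
  generalize ⟪w, w⟫ = W at *
  have hpos : 0 < t ^ 2 * U + W := by positivity
  rw [show ∀ x y z : ℝ, x - y ^ 2 / z < W ↔ x - W < y ^ 2 / z from
    fun x y z => by rw [sub_lt_comm],
    show t * (t * U - 0) - (t * 0 - W) = t ^ 2 * U + W by ring, lt_div_iff₀ hpos]
  have h3 : 0 ≤ U * W * (s * t - s ^ 2) := by
    have : 0 ≤ s * t - s ^ 2 := by linarith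
    positivity
  have h4 : 0 ≤ U * W * (s * t) := by
    have : 0 ≤ s * t := (sq_nonneg s).trans hst
    positivity
  nlinarith [mul_pos hW hW]

/-- Three reals cannot have pairwise negative products, so two of the points lie weakly on one side
of the origin; `y` is the nearer one. -/
theorem exists_sq_le_mul {α : Type*} (τ : α → ℝ) {p q s : α} (h₁ : τ p ≠ τ q) (h₂ : τ p ≠ τ s)
    (h₃ : τ q ≠ τ s) : ∃ y ∈ ({p, q, s} : Set α), ∃ z ∈ ({p, q, s} : Set α),
      τ y ≠ τ z ∧ τ y ^ 2 ≤ τ y * τ z := by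
  have key : ∀ y ∈ ({p, q, s} : Set α), ∀ z ∈ ({p, q, s} : Set α), τ y ≠ τ z → 0 ≤ τ y * τ z →
      ∃ y ∈ ({p, q, s} : Set α), ∃ z ∈ ({p, q, s} : Set α), τ y ≠ τ z ∧ τ y ^ 2 ≤ τ y * τ z := by
    intro y hy z hz hne h0
    by_cases h : τ y ^ 2 ≤ τ y * τ z
    · exact ⟨y, hy, z, hz, hne, h⟩
    · push Not at h
      refine ⟨z, hz, y, hy, hne.symm, ?_⟩
      by_contra hcon
      push Not at hcon
      have : 0 < τ y ^ 2 := h0.trans_lt h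
      nlinarith [mul_nonneg h0 (sub_nonneg.2 h.le), mul_pos this (sub_pos.2 hcon)]
  by_contra hcon
  have hp : p ∈ ({p, q, s} : Set α) := by simp
  have hq : q ∈ ({p, q, s} : Set α) := by simp
  have hs : s ∈ ({p, q, s} : Set α) := by simp
  have a1 : τ p * τ q < 0 := not_le.1 fun h => hcon (key p hp q hq h₁ h)
  have a2 : τ p * τ s < 0 := not_le.1 fun h => hcon (key p hp s hs h₂ h)
  have a3 : τ q * τ s < 0 := not_le.1 fun h => hcon (key q hq s hs h₃ h)
  nlinarith [mul_pos_of_neg_of_neg a1 a2, sq_nonneg (τ p)]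

/-- The Sylvester–Gallai theorem. -/
theorem exists_ordinary_pair {Q : Finset V}
    (hQ : ∃ p ∈ Q, ∃ q ∈ Q, ∃ r ∈ Q, p ≠ q ∧ r ∉ line[ℝ, p, q]) :
    ∃ p ∈ Q, ∃ q ∈ Q, p ≠ q ∧ ∀ s ∈ Q, s ∈ line[ℝ, p, q] → s = p ∨ s = q := by
  classical
  obtain ⟨⟨r, p, q⟩, hx, hmin⟩ := Finset.exists_min_image
    ((Q ×ˢ Q ×ˢ Q).filter fun x => x.2.1 ≠ x.2.2 ∧ x.1 ∉ line[ℝ, x.2.1, x.2.2])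
    (fun x => lineDistSq x.1 x.2.1 x.2.2) (by
      obtain ⟨p, hp, q, hq, r, hr, h1, h2⟩ := hQ
      exact ⟨(r, p, q), Finset.mem_filter.2
        ⟨Finset.mk_mem_product hr (Finset.mk_mem_product hp hq), h1, h2⟩⟩)
  simp only [Finset.mem_filter, Finset.mem_product, Prod.forall] at hx hmin
  obtain ⟨⟨hr, hp, hq⟩, hpq, hrl⟩ := hx
  refine ⟨p, hp, q, hq, hpq, fun s hs hsl => ?_⟩
  by_contra hcon
  push Not at hcon
  obtain ⟨hsp, hsq⟩ := hcon
  set u := q - p with hu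
  have hu0 : u ≠ 0 := sub_ne_zero.2 hpq.symm
  have hU : ⟪u, u⟫ ≠ 0 := inner_self_ne_zero.2 hu0
  set h := p + (⟪r - p, u⟫ / ⟪u, u⟫) • u with hh
  set w := r - h with hw
  have hrw : h + w = r := by rw [hw]; abel
  have huw : ⟪w, u⟫ = 0 := by
    rw [hw, hh, ← sub_sub, inner_sub_left, inner_smul_left, RCLike.conj_to_real,
      div_mul_cancel₀ _ hU, sub_self]
  have hw0 : w ≠ 0 := fun h0 => hrl <| mem_line_iff.2 ⟨⟪r - p, u⟫ / ⟪u, u⟫, by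
    rw [h0, add_zero] at hrw
    calc r - p = h - p := by rw [← hrw]
      _ = _ := by rw [hh, add_sub_cancel_left]⟩
  have hτ : ∀ x : V, ∃ t : ℝ, x ∈ line[ℝ, p, q] → x = h + t • u := by
    intro x
    by_cases hx : x ∈ line[ℝ, p, q]
    · obtain ⟨t, ht⟩ := mem_line_iff.1 hx
      refine ⟨t - ⟪r - p, u⟫ / ⟪u, u⟫, fun _ => ?_⟩
      rw [hh, sub_smul, ← ht]; abel
    · exact ⟨0, fun h => absurd h hx⟩
  choose τ hτ using hτ
  have hpl : p ∈ line[ℝ, p, q] := left_mem_affineSpan_pair ..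
  have hql : q ∈ line[ℝ, p, q] := right_mem_affineSpan_pair ..
  have hinj : ∀ x y, x ∈ line[ℝ, p, q] → y ∈ line[ℝ, p, q] → x ≠ y → τ x ≠ τ y :=
    fun x y hx hy hne h' => hne (by rw [hτ x hx, hτ y hy, h'])
  obtain ⟨y, hy, z, hz, hyz, hle⟩ := exists_sq_le_mul τ (hinj p q hpl hql hpq)
    (hinj p s hpl hsl hsp.symm) (hinj q s hql hsl hsq.symm)
  have hmem : ∀ x ∈ ({p, q, s} : Set V), x ∈ Q ∧ x ∈ line[ℝ, p, q] := by
    rintro x (rfl | rfl | rfl)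
    exacts [⟨hp, hpl⟩, ⟨hq, hql⟩, ⟨hs, hsl⟩]
  obtain ⟨hyQ, hyl⟩ := hmem y hy
  obtain ⟨hzQ, hzl⟩ := hmem z hz
  have hyz' : y ≠ z := fun h' => hyz (by rw [h'])
  -- A third point on the line would make `y` closer to the line `rz` than `r` is to the line `pq`,
  -- against minimality.
  have h1 := hmin y r z ⟨⟨hyQ, hr, hzQ⟩, fun h' => hrl (h' ▸ hzl), fun h' =>
    hyz' (eq_of_mem_of_notMem hyl hzl hrl h' (right_mem_affineSpan_pair ..))⟩
  have h2 : lineDistSq r p q = ⟪w, w⟫ := by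
    have := lineDistSq_eq (h := h) hu0 huw (hinj p q hpl hql hpq)
    rwa [hrw, ← hτ p hpl, ← hτ q hql] at this
  have h3 := lineDistSq_lt (h := h) hw0 huw hle
  rw [hrw, ← hτ y hyl, ← hτ z hzl] at h3
  linarith

end SylvesterGallai

/-! ### Planes, ordinary lines and their incidences in space -/

/-- The affine subspace through three points. -/
noncomputable def planeThrough (a b c : Space3) : AffineSubspace ℝ Space3 :=
  AffineSubspace.mk' a (Submodule.span ℝ {b - a, c - a})

theorem mem_planeThrough_iff {a b c r : Space3} :
    r ∈ planeThrough a b c ↔ ∃ x y : ℝ, x • (b - a) + y • (c - a) = r - a := by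
  rw [planeThrough, AffineSubspace.mem_mk', vsub_eq_sub, Submodule.mem_span_pair]

theorem first_mem_planeThrough (a b c : Space3) : a ∈ planeThrough a b c :=
  mem_planeThrough_iff.2 ⟨0, 0, by simp⟩

theorem second_mem_planeThrough (a b c : Space3) : b ∈ planeThrough a b c :=
  mem_planeThrough_iff.2 ⟨1, 0, by simp⟩

theorem third_mem_planeThrough (a b c : Space3) : c ∈ planeThrough a b c :=
  mem_planeThrough_iff.2 ⟨0, 1, by simp⟩

theorem isPlane_planeThrough {a b c : Space3} (hab : a ≠ b) (hc : c ∉ line[ℝ, a, b]) :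
    IsPlane (planeThrough a b c) := by
  have hli : LinearIndependent ℝ ![b - a, c - a] := by
    rw [LinearIndependent.pair_iff]
    intro s t hst
    have ht : t = 0 := by
      by_contra ht
      refine hc (mem_line_iff.2 ⟨-(t⁻¹ * s), ?_⟩)
      have : t • (c - a) = -(s • (b - a)) := by rw [eq_neg_iff_add_eq_zero, add_comm]; exact hst
      rw [neg_smul, mul_smul, ← smul_neg, ← this, smul_smul, inv_mul_cancel₀ ht, one_smul]
    rw [ht, zero_smul, add_zero, smul_eq_zero] at hst
    exact ⟨hst.resolve_right (sub_ne_zero.2 hab.symm), ht⟩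
  have := finrank_span_eq_card hli
  rw [Matrix.range_cons, Matrix.range_cons, Matrix.range_empty, Set.union_empty,
    Set.singleton_union, Fintype.card_fin] at this
  rw [IsPlane, planeThrough, AffineSubspace.direction_mk']
  exact this

theorem IsPlane.eq_planeThrough {H : AffineSubspace ℝ Space3} (hH : IsPlane H) {a b c : Space3}
    (ha : a ∈ H) (hb : b ∈ H) (hc : c ∈ H) (hab : a ≠ b) (hcl : c ∉ line[ℝ, a, b]) :
    H = planeThrough a b c := by
  have hle : planeThrough a b c ≤ H := by
    intro r hr
    obtain ⟨x, y, hxy⟩ := mem_planeThrough_iff.1 hr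
    have h1 : r - a ∈ H.direction := by
      rw [← hxy]
      exact H.direction.add_mem (H.direction.smul_mem _ (AffineSubspace.vsub_mem_direction hb ha))
        (H.direction.smul_mem _ (AffineSubspace.vsub_mem_direction hc ha))
    have := AffineSubspace.vadd_mem_of_mem_direction h1 ha
    simpa using this
  refine (AffineSubspace.eq_of_direction_eq_of_nonempty_of_le ?_
    ⟨a, first_mem_planeThrough a b c⟩ hle).symm
  refine Submodule.eq_of_le_of_finrank_eq (AffineSubspace.direction_le hle) ?_
  rw [isPlane_planeThrough hab hcl, hH]

theorem exists_notMem_line (a b : Space3) : ∃ c, c ∉ line[ℝ, a, b] := by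
  by_contra hcon
  push Not at hcon
  have h : Submodule.span ℝ {b - a} = ⊤ := by
    rw [eq_top_iff]
    intro v _
    obtain ⟨t, ht⟩ := mem_line_iff.1 (hcon (a + v))
    rw [add_sub_cancel_left] at ht
    exact Submodule.mem_span_singleton.2 ⟨t, ht.symm⟩
  have h1 := finrank_span_le_card (R := ℝ) ({b - a} : Set Space3)
  rw [h, finrank_top, finrank_euclideanSpace_fin] at h1
  simp at h1

theorem exists_isPlane_mem (a b : Space3) : ∃ H, IsPlane H ∧ a ∈ H ∧ b ∈ H := by
  have key : ∀ a b : Space3, a ≠ b → ∃ H, IsPlane H ∧ a ∈ H ∧ b ∈ H := fun a b hab => by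
    obtain ⟨c, hc⟩ := exists_notMem_line a b
    exact ⟨_, isPlane_planeThrough hab hc, first_mem_planeThrough a b c,
      second_mem_planeThrough a b c⟩
  by_cases hab : a = b
  · obtain ⟨c, hc⟩ := exists_ne a
    obtain ⟨H, h1, h2, -⟩ := key a c hc.symm
    exact ⟨H, h1, h2, hab ▸ h2⟩
  · exact key a b hab

open Classical in
/-- The planes spanned by the points of `P`. -/
noncomputable def spannedPlanes (P : Finset Space3) : Finset (AffineSubspace ℝ Space3) :=
  ((P ×ˢ P ×ˢ P).filter fun x => x.1 ≠ x.2.1 ∧ x.2.2 ∉ line[ℝ, x.1, x.2.1]).image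
    fun x => planeThrough x.1 x.2.1 x.2.2

theorem mem_spannedPlanes {P : Finset Space3} {H : AffineSubspace ℝ Space3} :
    H ∈ spannedPlanes P ↔ ∃ a ∈ P, ∃ b ∈ P, ∃ c ∈ P, a ≠ b ∧ c ∉ line[ℝ, a, b] ∧
      planeThrough a b c = H := by
  classical
  simp only [spannedPlanes, Finset.mem_image, Finset.mem_filter, Finset.mem_product, Prod.exists]
  constructor
  · rintro ⟨a, b, c, ⟨⟨ha, hb, hc⟩, h1, h2⟩, h3⟩
    exact ⟨a, ha, b, hb, c, hc, h1, h2, h3⟩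
  · rintro ⟨a, ha, b, hb, c, hc, h1, h2, h3⟩
    exact ⟨a, b, c, ⟨⟨ha, hb, hc⟩, h1, h2⟩, h3⟩

open Classical in
/-- The ordinary lines, as a finite set. -/
noncomputable def ordinaryFinset (P : Finset Space3) : Finset (AffineSubspace ℝ Space3) :=
  (spannedLines P).filter fun ℓ => (ptsIn P ℓ).card = 2

theorem coe_ptsIn (P : Finset Space3) (H : AffineSubspace ℝ Space3) :
    (ptsIn P H : Set Space3) = (P : Set Space3) ∩ (H : Set Space3) := by
  ext r
  simp [mem_ptsIn]

theorem ncard_inter (P : Finset Space3) (H : AffineSubspace ℝ Space3) :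
    ((P : Set Space3) ∩ (H : Set Space3)).ncard = (ptsIn P H).card := by
  rw [← coe_ptsIn, Set.ncard_coe_finset]

theorem isLine_line {p q : Space3} (hpq : p ≠ q) : IsLine line[ℝ, p, q] := by
  rw [IsLine, direction_affineSpan, vectorSpan_pair_rev, finrank_span_singleton]
  exact sub_ne_zero.2 hpq.symm

theorem coe_ordinaryFinset (P : Finset Space3) :
    (ordinaryFinset P : Set (AffineSubspace ℝ Space3)) = ordinaryLines P := by
  classical
  ext ℓ
  simp only [ordinaryFinset, Finset.coe_filter, Set.mem_ofPred_eq, ordinaryLines, ncard_inter]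
  refine and_congr_left fun h2 => ⟨fun h => ?_, fun h => ?_⟩
  · obtain ⟨p, -, q, -, hpq, rfl⟩ := mem_spannedLines.1 h
    exact isLine_line hpq
  · obtain ⟨p, q, hpq, he⟩ := Finset.card_eq_two.1 h2
    have hp : p ∈ ptsIn P ℓ := he ▸ Finset.mem_insert_self _ _
    have hq : q ∈ ptsIn P ℓ := he ▸ Finset.mem_insert_of_mem (Finset.mem_singleton_self _)
    rw [mem_ptsIn] at hp hq
    refine mem_spannedLines.2 ⟨p, hp.1, q, hq.1, hpq, ?_⟩
    have hle : line[ℝ, p, q] ≤ ℓ := affineSpan_pair_le_of_mem_of_mem hp.2 hq.2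
    refine AffineSubspace.eq_of_direction_eq_of_nonempty_of_le
      (Submodule.eq_of_le_of_finrank_eq (AffineSubspace.direction_le hle) ?_)
      ⟨p, left_mem_affineSpan_pair ..⟩ hle
    rw [isLine_line hpq, h]

theorem ncard_ordinaryLines (P : Finset Space3) :
    (ordinaryLines P).ncard = (ordinaryFinset P).card := by
  rw [← coe_ordinaryFinset, Set.ncard_coe_finset]

theorem line_mem_ordinaryFinset {P : Finset Space3} {p q : Space3} (hp : p ∈ P) (hq : q ∈ P)
    (hpq : p ≠ q) (h : ∀ s ∈ P, s ∈ line[ℝ, p, q] → s = p ∨ s = q) :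
    line[ℝ, p, q] ∈ ordinaryFinset P := by
  classical
  refine Finset.mem_filter.2 ⟨mem_spannedLines.2 ⟨p, hp, q, hq, hpq, rfl⟩, ?_⟩
  refine le_antisymm ?_ (two_le_card_ptsIn hp hq hpq)
  rw [← Finset.card_pair hpq]
  refine Finset.card_le_card fun s hs => ?_
  obtain ⟨h1, h2⟩ := mem_ptsIn.1 hs
  simpa using h s h1 h2

open Classical in
/-- If many planes pass through each of many points, then there are many ordinary lines. -/
theorem card_mul_le_ordinary {P A : Finset Space3} (hA : A ⊆ P) {M : ℝ}
    (hM : ∀ a ∈ A, M ≤ ((spannedPlanes P).filter fun H => a ∈ H).card) :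
    A.card * M ≤ 3 * P.card * (ordinaryFinset P).card := by
  -- A line inside `H` meets `P` only within `H`, so a line ordinary for the points in `H` is
  -- ordinary for `P`.
  have ho : ∀ H : AffineSubspace ℝ Space3, ∃ ℓ, H ∈ spannedPlanes P →
      ℓ ∈ ordinaryFinset P ∧ ℓ ≤ H := by
    intro H
    by_cases hH : H ∈ spannedPlanes P
    · obtain ⟨a, ha, b, hb, c, hc, hab, hcl, rfl⟩ := mem_spannedPlanes.1 hH
      obtain ⟨p, hp, q, hq, hpq, h⟩ := exists_ordinary_pair (Q := ptsIn P (planeThrough a b c))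
        ⟨a, mem_ptsIn.2 ⟨ha, first_mem_planeThrough a b c⟩, b,
          mem_ptsIn.2 ⟨hb, second_mem_planeThrough a b c⟩, c,
          mem_ptsIn.2 ⟨hc, third_mem_planeThrough a b c⟩, hab, hcl⟩
      rw [mem_ptsIn] at hp hq
      have hle := affineSpan_pair_le_of_mem_of_mem hp.2 hq.2
      exact ⟨_, fun _ => ⟨line_mem_ordinaryFinset hp.1 hq.1 hpq fun s hs hsl =>
        h s (mem_ptsIn.2 ⟨hs, hle hsl⟩) hsl, hle⟩⟩
    · exact ⟨⊥, fun h => absurd h hH⟩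
  choose o ho using ho
  set J := (spannedPlanes P ×ˢ P).filter fun x => x.2 ∈ x.1 ∧ x.2 ∉ o x.1 with hJ
  have h1 : ((A.card : ℝ)) * M ≤ (∑ a ∈ P, ((spannedPlanes P).filter fun H => a ∈ H).card : ℕ) := by
    push_cast
    calc (A.card : ℝ) * M = ∑ _a ∈ A, M := by rw [Finset.sum_const, nsmul_eq_mul]
      _ ≤ ∑ a ∈ A, (((spannedPlanes P).filter fun H => a ∈ H).card : ℝ) := Finset.sum_le_sum hM
      _ ≤ _ := Finset.sum_le_sum_of_subset_of_nonneg hA fun _ _ _ => by positivity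
  have h2 : ∑ a ∈ P, ((spannedPlanes P).filter fun H => a ∈ H).card =
      ∑ H ∈ spannedPlanes P, (ptsIn P H).card := by
    simp only [ptsIn, Finset.card_filter]
    exact Finset.sum_comm
  -- If `m ≥ 3` points lie in the plane, then `m ≤ 3 * (m - 2)`.
  have h3 : ∑ H ∈ spannedPlanes P, (ptsIn P H).card ≤ 3 * J.card := by
    rw [Finset.card_eq_sum_card_fiberwise (f := Prod.fst) (t := spannedPlanes P)
      fun x hx => (Finset.mem_product.1 (Finset.mem_filter.1 hx).1).1, Finset.mul_sum]
    refine Finset.sum_le_sum fun H hH => ?_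
    have hfib : ptsIn P H \ ptsIn P (o H) ⊆ (J.filter fun x => x.1 = H).image Prod.snd := by
      intro a ha
      obtain ⟨ha1, ha2⟩ := Finset.mem_sdiff.1 ha
      rw [mem_ptsIn] at ha1 ha2
      exact Finset.mem_image.2 ⟨(H, a), Finset.mem_filter.2 ⟨Finset.mem_filter.2
        ⟨Finset.mk_mem_product hH ha1.1, ha1.2, fun h => ha2 ⟨ha1.1, h⟩⟩, rfl⟩, rfl⟩
    have h4 := (Finset.card_le_card hfib).trans Finset.card_image_le
    have hsub : ptsIn P (o H) ⊆ ptsIn P H := fun r hr =>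
      mem_ptsIn.2 ⟨(mem_ptsIn.1 hr).1, (ho H hH).2 (mem_ptsIn.1 hr).2⟩
    rw [Finset.card_sdiff_of_subset hsub, (Finset.mem_filter.1 (ho H hH).1).2] at h4
    have h5 : 3 ≤ (ptsIn P H).card := by
      obtain ⟨a, ha, b, hb, c, hc, hab, hcl, rfl⟩ := mem_spannedPlanes.1 hH
      have hca : a ≠ c := fun h => hcl (h ▸ left_mem_affineSpan_pair ℝ a b)
      have hcb : b ≠ c := fun h => hcl (h ▸ right_mem_affineSpan_pair ℝ a b)
      have h6 : ({a, b, c} : Finset Space3).card = 3 :=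
        Finset.card_eq_three.2 ⟨a, b, c, hab, hca, hcb, rfl⟩
      refine h6.symm.le.trans (Finset.card_le_card fun r hr => ?_)
      simp only [Finset.mem_insert, Finset.mem_singleton] at hr
      rcases hr with rfl | rfl | rfl
      · exact mem_ptsIn.2 ⟨ha, first_mem_planeThrough _ _ _⟩
      · exact mem_ptsIn.2 ⟨hb, second_mem_planeThrough _ _ _⟩
      · exact mem_ptsIn.2 ⟨hc, third_mem_planeThrough _ _ _⟩
    refine le_trans ?_ (Nat.mul_le_mul_left 3 h4)
    omega
  have h4 : J.card ≤ (ordinaryFinset P).card * P.card := by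
    rw [← Finset.card_product]
    refine Finset.card_le_card_of_injOn (fun x => (o x.1, x.2)) ?_ ?_
    · intro x hx
      obtain ⟨h, -⟩ := Finset.mem_filter.1 hx
      obtain ⟨h5, h6⟩ := Finset.mem_product.1 h
      exact Finset.mk_mem_product (ho _ h5).1 h6
    · rintro ⟨H, a⟩ hx ⟨H', a'⟩ hx' heq
      obtain ⟨hx1, hx2, hx3⟩ := Finset.mem_filter.1 hx
      obtain ⟨hx1', hx2', hx3'⟩ := Finset.mem_filter.1 hx'
      obtain ⟨heq1, heq2⟩ := Prod.ext_iff.1 heq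
      simp only at heq1 heq2 hx2 hx3 hx2' hx3'
      subst heq2
      have hH := (Finset.mem_product.1 hx1).1
      have hH' := (Finset.mem_product.1 hx1').1
      have hHP : ∀ H ∈ spannedPlanes P, IsPlane H := fun H hH => by
        obtain ⟨a, -, b, -, c, -, hab, hcl, rfl⟩ := mem_spannedPlanes.1 hH
        exact isPlane_planeThrough hab hcl
      obtain ⟨p, hp, q, hq, hpq, hl⟩ := mem_spannedLines.1 (Finset.mem_filter.1 (ho H hH).1).1
      have hpo : p ∈ o H := hl.le (left_mem_affineSpan_pair ℝ p q)
      have hqo : q ∈ o H := hl.le (right_mem_affineSpan_pair ℝ p q)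
      have e1 := (hHP H hH).eq_planeThrough ((ho H hH).2 hpo) ((ho H hH).2 hqo) hx2 hpq
        (fun h => hx3 (hl.le h))
      have e2 := (hHP H' hH').eq_planeThrough ((ho H' hH').2 (heq1.le hpo))
        ((ho H' hH').2 (heq1.le hqo)) hx2' hpq (fun h => hx3 (hl.le h))
      rw [e1, e2]
  refine h1.trans ?_
  rw [h2]
  have := h3.trans (Nat.mul_le_mul_left 3 h4)
  calc ((∑ H ∈ spannedPlanes P, (ptsIn P H).card : ℕ) : ℝ)
      ≤ ((3 * ((ordinaryFinset P).card * P.card) : ℕ) : ℝ) := by exact_mod_cast this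
    _ = _ := by push_cast; ring

/-! ### Projection from a point of the set -/

/-- In the chart `f = 1`, collinearity is membership in a linear span; applying `f` forces the
rescaled coefficients to sum to one. -/
theorem central_projection_mem_line_iff {V : Type*} [AddCommGroup V] [Module ℝ V]
    {f : Module.Dual ℝ V} {u v w : V} (hu : f u = 1) (hv : f v = 1) (hw : f w = 1) {α β γ : ℝ}
    (hα : α ≠ 0) (hβ : β ≠ 0) (hγ : γ ≠ 0) :
    w ∈ line[ℝ, u, v] ↔ ∃ x y : ℝ, x • α • u + y • β • v = γ • w := by
  rw [mem_line_iff]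
  constructor
  · rintro ⟨t, ht⟩
    refine ⟨γ * (1 - t) * α⁻¹, γ * t * β⁻¹, ?_⟩
    rw [smul_smul, smul_smul, inv_mul_cancel_right₀ hα, inv_mul_cancel_right₀ hβ,
      sub_eq_iff_eq_add.1 ht]
    module
  · rintro ⟨x, y, hxy⟩
    have h1 : x * α + y * β = γ := by
      have := congrArg f hxy
      simpa [hu, hv, hw] using this
    refine ⟨γ⁻¹ * (y * β), ?_⟩
    have h2 : w = γ⁻¹ • (x • α • u + y • β • v) := by
      rw [hxy, smul_smul, inv_mul_cancel₀ hγ, one_smul]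
    have h3 : u = (γ⁻¹ * (x * α + y * β)) • u := by rw [h1, inv_mul_cancel₀ hγ, one_smul]
    have h4 : γ⁻¹ * (y * β) = 1 - γ⁻¹ * (x * α) := by
      have : γ⁻¹ * (x * α + y * β) = 1 := by rw [h1, inv_mul_cancel₀ hγ]
      linarith
    rw [h2, smul_sub]
    nth_rw 2 [h3]
    module

open Classical in
/-- Beck's theorem for the projection of `P` from one of its points. -/
theorem exists_card_planes_through_ge {ε : ℝ} (hε : 0 < ε) {K : ℕ} (hK : 0 < K) :
    ∃ c : ℝ, 0 < c ∧ ∀ (P : Finset Space3), ∀ a ∈ P,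
    (∃ b ∈ P, ∃ c ∈ P, a ≠ b ∧ c ∉ line[ℝ, a, b]) →
    (∀ b ∈ P, ∀ c ∈ P, a ≠ b → c ∉ line[ℝ, a, b] → ∃ G ⊆ P,
      (∀ g ∈ G, g ∉ planeThrough a b c) ∧ ε * P.card ≤ G.card ∧
        ∀ g ∈ G, (ptsIn G line[ℝ, a, g]).card ≤ K) →
    c * (P.card : ℝ) ^ 2 ≤ ((spannedPlanes P).filter fun H => a ∈ H).card := by
  have hK' : (0 : ℝ) < K := by exact_mod_cast hK
  obtain ⟨c₀, hc₀, hbeck⟩ := exists_card_spannedLines_ge (V := Space3) (div_pos hε hK')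
  refine ⟨c₀ * (ε / K) ^ 2, by positivity, fun P a ha hnc hG => ?_⟩
  obtain ⟨f, hf⟩ := exists_dual_ne_zero ((P.image fun b => b - a).finite_toSet)
  replace hf : ∀ b ∈ P, b ≠ a → f (b - a) ≠ 0 := fun b hb hne =>
    hf _ (Finset.mem_coe.2 (Finset.mem_image_of_mem _ hb)) (sub_ne_zero.2 hne)
  obtain ⟨π, hπ⟩ : ∃ π : Space3 → Space3, ∀ b, π b = (f (b - a))⁻¹ • (b - a) :=
    ⟨fun b => (f (b - a))⁻¹ • (b - a), fun _ => rfl⟩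
  have hπs : ∀ b ∈ P, b ≠ a → b - a = f (b - a) • π b := fun b hb hne => by
    rw [hπ, smul_smul, mul_inv_cancel₀ (hf b hb hne), one_smul]
  have hfπ : ∀ b ∈ P, b ≠ a → f (π b) = 1 := fun b hb hne => by
    rw [hπ, map_smul, smul_eq_mul, inv_mul_cancel₀ (hf b hb hne)]
  have hπeq : ∀ b ∈ P, b ≠ a → ∀ c ∈ P, c ≠ a → (π b = π c ↔ c ∈ line[ℝ, a, b]) := by
    intro b hb hba c hc hca
    rw [mem_line_iff]
    constructor
    · intro h
      refine ⟨f (c - a) * (f (b - a))⁻¹, ?_⟩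
      rw [mul_smul, ← hπ, h]
      exact hπs c hc hca
    · rintro ⟨t, ht⟩
      have ht0 : t ≠ 0 := fun h0 => hca (by rwa [h0, zero_smul, sub_eq_zero] at ht)
      rw [hπ c, ht, map_smul, smul_smul, smul_eq_mul, mul_inv_rev, mul_assoc,
        inv_mul_cancel₀ ht0, mul_one, hπ]
  have hπline : ∀ b ∈ P, b ≠ a → ∀ c ∈ P, c ≠ a → ∀ g ∈ P, g ≠ a →
      (π g ∈ line[ℝ, π b, π c] ↔ g ∈ planeThrough a b c) := by
    intro b hb hba c hc hca g hg hga
    rw [central_projection_mem_line_iff (hfπ b hb hba) (hfπ c hc hca) (hfπ g hg hga)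
      (hf b hb hba) (hf c hc hca) (hf g hg hga), mem_planeThrough_iff, ← hπs b hb hba,
      ← hπs c hc hca, ← hπs g hg hga]
  set D := (P.erase a).image π with hD
  have hDmem : ∀ p ∈ D, ∃ b ∈ P, b ≠ a ∧ π b = p := fun p hp => by
    obtain ⟨b, hb, h⟩ := Finset.mem_image.1 hp
    exact ⟨b, (Finset.mem_erase.1 hb).2, (Finset.mem_erase.1 hb).1, h⟩
  have hmemD : ∀ b ∈ P, b ≠ a → π b ∈ D := fun b hb hne =>
    Finset.mem_image_of_mem _ (Finset.mem_erase.2 ⟨hne, hb⟩)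
  have hDP : (D.card : ℝ) ≤ P.card := by
    exact_mod_cast Finset.card_image_le.trans (Finset.card_le_card (Finset.erase_subset a P))
  -- The set `G` avoids the plane over this line and the fibres of `π` on it have at most `K`
  -- points, so its image leaves `ε / K * P.card` points off the line.
  have hoff : ∀ b ∈ P, b ≠ a → ∀ c ∈ P, c ≠ a → π b ≠ π c →
      ε / K * P.card ≤ ((D.card - (ptsIn D line[ℝ, π b, π c]).card : ℕ) : ℝ) := by
    intro b hb hba c hc hca hbc
    obtain ⟨G, hGP, hGpl, hGcard, hGfib⟩ := hG b hb c hc hba.symm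
      (fun h => hbc ((hπeq b hb hba c hc hca).2 h))
    have hga : ∀ g ∈ G, g ≠ a := fun g hg h => hGpl g hg (h ▸ first_mem_planeThrough a b c)
    have h1 : G.card ≤ K * (G.image π).card := by
      refine Finset.card_le_mul_card_image _ _ fun p hp => ?_
      obtain ⟨g, hg, rfl⟩ := Finset.mem_image.1 hp
      refine (Finset.card_le_card fun g' hg' => ?_).trans (hGfib g hg)
      obtain ⟨hg1, hg2⟩ := Finset.mem_filter.1 hg'
      exact mem_ptsIn.2 ⟨hg1, (hπeq g (hGP hg) (hga g hg) g' (hGP hg1) (hga g' hg1)).1 hg2.symm⟩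
    have h2 : G.image π ⊆ D \ ptsIn D line[ℝ, π b, π c] := by
      intro p hp
      obtain ⟨g, hg, rfl⟩ := Finset.mem_image.1 hp
      refine Finset.mem_sdiff.2 ⟨hmemD g (hGP hg) (hga g hg), fun h => hGpl g hg ?_⟩
      exact (hπline b hb hba c hc hca g (hGP hg) (hga g hg)).1 (mem_ptsIn.1 h).2
    have h3 := Finset.card_le_card h2
    rw [Finset.card_sdiff_of_subset (ptsIn_subset _ _)] at h3
    have h4 : (G.card : ℝ) ≤ K * ((D.card - (ptsIn D line[ℝ, π b, π c]).card : ℕ) : ℝ) := by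
      exact_mod_cast h1.trans (Nat.mul_le_mul_left _ h3)
    rw [div_mul_eq_mul_div, div_le_iff₀ hK']
    linarith
  obtain ⟨b₀, hb₀, c₁, hc₁, hab, hcl⟩ := hnc
  have hca : c₁ ≠ a := fun h => hcl (h ▸ left_mem_affineSpan_pair ℝ a b₀)
  have hne : π b₀ ≠ π c₁ := fun h => hcl ((hπeq b₀ hb₀ hab.symm c₁ hc₁ hca).1 h)
  have hD2 : 2 ≤ D.card := Finset.one_lt_card.2
    ⟨_, hmemD b₀ hb₀ hab.symm, _, hmemD c₁ hc₁ hca, hne⟩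
  have hDlow : ε / K * P.card ≤ D.card :=
    (hoff b₀ hb₀ hab.symm c₁ hc₁ hca hne).trans (by exact_mod_cast Nat.sub_le _ _)
  have hlines := hbeck D hD2 (by
    intro p hp q hq hpq
    obtain ⟨b, hb, hba, rfl⟩ := hDmem p hp
    obtain ⟨c, hc, hca, rfl⟩ := hDmem q hq
    refine le_trans ?_ (hoff b hb hba c hc hca hpq)
    gcongr)
  have hcard : (spannedLines D).card ≤ ((spannedPlanes P).filter fun H => a ∈ H).card := by
    have hrep : ∀ m : AffineSubspace ℝ Space3, ∃ x : Space3 × Space3, m ∈ spannedLines D →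
        (x.1 ∈ P ∧ x.1 ≠ a) ∧ (x.2 ∈ P ∧ x.2 ≠ a) ∧ π x.1 ≠ π x.2 ∧
          line[ℝ, π x.1, π x.2] = m := by
      intro m
      by_cases hm : m ∈ spannedLines D
      · obtain ⟨p, hp, q, hq, hpq, h⟩ := mem_spannedLines.1 hm
        obtain ⟨b, hb, hba, rfl⟩ := hDmem p hp
        obtain ⟨c, hc, hca, rfl⟩ := hDmem q hq
        exact ⟨(b, c), fun _ => ⟨⟨hb, hba⟩, ⟨hc, hca⟩, hpq, h⟩⟩
      · exact ⟨0, fun h => absurd h hm⟩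
    choose x hx using hrep
    refine Finset.card_le_card_of_injOn (fun m => planeThrough a (x m).1 (x m).2) ?_ ?_
    · intro m hm
      obtain ⟨⟨hb, hba⟩, ⟨hc, hca⟩, hpq, -⟩ := hx m hm
      refine Finset.mem_filter.2 ⟨mem_spannedPlanes.2 ⟨a, ha, _, hb, _, hc, hba.symm,
        fun h => hpq ((hπeq _ hb hba _ hc hca).2 h), rfl⟩, first_mem_planeThrough _ _ _⟩
    · intro m hm m' hm' heq
      obtain ⟨⟨hb, hba⟩, ⟨hc, hca⟩, hpq, hl⟩ := hx m hm
      obtain ⟨⟨hb', hba'⟩, ⟨hc', hca'⟩, hpq', hl'⟩ := hx m' hm'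
      simp only at heq
      have h1 : π (x m').1 ∈ line[ℝ, π (x m).1, π (x m).2] :=
        (hπline _ hb hba _ hc hca _ hb' hba').2 (heq ▸ second_mem_planeThrough _ _ _)
      have h2 : π (x m').2 ∈ line[ℝ, π (x m).1, π (x m).2] :=
        (hπline _ hb hba _ hc hca _ hc' hca').2 (heq ▸ third_mem_planeThrough _ _ _)
      rw [← hl, ← hl', line_eq_of_mem h1 h2 hpq']
  calc c₀ * (ε / K) ^ 2 * (P.card : ℝ) ^ 2 = c₀ * (ε / K * P.card) ^ 2 := by ring
    _ ≤ c₀ * (D.card : ℝ) ^ 2 := by gcongr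
    _ ≤ (spannedLines D).card := hlines
    _ ≤ _ := by exact_mod_cast hcard

/-! ### The two cases: no rich line, and a rich line -/

theorem card_spread_of_plane_bound {P : Finset Space3} {δ : ℝ}
    (hδ : ∀ H, IsPlane H → δ * P.card ≤ ((P \ ptsIn P H).card : ℝ))
    (h0 : 0 < δ * P.card) (a : Space3) :
    ∃ b ∈ P, ∃ c ∈ P, a ≠ b ∧ c ∉ line[ℝ, a, b] := by
  have key : ∀ H, IsPlane H → ∃ r ∈ P, r ∉ H := fun H hH => by
    have : 0 < (P \ ptsIn P H).card := by exact_mod_cast h0.trans_le (hδ H hH)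
    obtain ⟨r, hr⟩ := Finset.card_pos.1 this
    obtain ⟨h1, h2⟩ := Finset.mem_sdiff.1 hr
    exact ⟨r, h1, fun h => h2 (mem_ptsIn.2 ⟨h1, h⟩)⟩
  obtain ⟨H, hH, haH, -⟩ := exists_isPlane_mem a a
  obtain ⟨b, hb, hbH⟩ := key H hH
  obtain ⟨H', hH', ha', hb'⟩ := exists_isPlane_mem a b
  obtain ⟨c, hc, hcH⟩ := key H' hH'
  exact ⟨b, hb, c, hc, fun h => hbH (h ▸ haH), fun h =>
    hcH (affineSpan_pair_le_of_mem_of_mem ha' hb' h)⟩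

open Classical in
/-- If no line is rich, then most points of `P` see many planes, hence many ordinary lines. -/
theorem exists_ordinary_ge_of_no_rich_line {δ : ℝ} (hδ0 : 0 < δ) :
    ∃ β : ℝ, 0 < β ∧ ∃ c : ℝ, 0 < c ∧ ∀ P : Finset Space3, 0 < P.card →
      (∀ H, IsPlane H → δ * P.card ≤ ((P \ ptsIn P H).card : ℝ)) →
      (∀ p ∈ P, ∀ q ∈ P, p ≠ q → ((ptsIn P line[ℝ, p, q]).card : ℝ) ≤ β * P.card) →
      c * (P.card : ℝ) ^ 2 ≤ (ordinaryFinset P).card := by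
  obtain ⟨K, hK, β, hβ, hpairs⟩ := exists_card_pairsBetween_le (V := Space3)
    (show 0 < δ / 4 by positivity)
  obtain ⟨c₁, hc₁, hproj⟩ := exists_card_planes_through_ge (show 0 < δ / 2 by positivity) hK
  refine ⟨β, hβ, c₁ / 6, by positivity, fun P hP hδ hline => ?_⟩
  set n : ℝ := (P.card : ℝ) with hn
  have hn0 : 0 < n := by rw [hn]; exact_mod_cast hP
  set Q := pairsBetween P K (β * n) with hQ
  have hQc : (Q.card : ℝ) ≤ δ / 4 * n ^ 2 := hpairs P
  set bad : Space3 → Finset Space3 := fun a => P.filter fun b => (a, b) ∈ Q with hbad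
  set A := P.filter fun a => ((bad a).card : ℝ) ≤ δ / 2 * n with hA
  have hsum : ∑ a ∈ P, ((bad a).card : ℝ) ≤ Q.card := by
    rw [Finset.card_eq_sum_card_fiberwise (s := Q) (f := Prod.fst) (t := P) (fun x hx =>
      (Finset.mem_offDiag.1 (Finset.mem_filter.1 hx).1).1)]
    push_cast
    refine Finset.sum_le_sum fun a _ => ?_
    have : bad a ⊆ (Q.filter fun x => x.1 = a).image Prod.snd := fun b hb =>
      Finset.mem_image.2 ⟨(a, b), Finset.mem_filter.2 ⟨(Finset.mem_filter.1 hb).2, rfl⟩, rfl⟩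
    exact_mod_cast (Finset.card_le_card this).trans Finset.card_image_le
  -- Markov's inequality: `Q` has at most `δ / 4 * n ^ 2` pairs, so at most `n / 2` points have more
  -- than `δ / 2 * n` bad partners.
  have hAc : n / 2 ≤ A.card := by
    have h1 : ((P \ A).card : ℝ) * (δ / 2 * n) ≤ ∑ a ∈ P, ((bad a).card : ℝ) := by
      calc ((P \ A).card : ℝ) * (δ / 2 * n) = ∑ _a ∈ P \ A, δ / 2 * n := by
            rw [Finset.sum_const, nsmul_eq_mul]
        _ ≤ ∑ a ∈ P \ A, ((bad a).card : ℝ) := by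
            refine Finset.sum_le_sum fun a ha => ?_
            obtain ⟨haP, haA⟩ := Finset.mem_sdiff.1 ha
            by_contra hcon
            push Not at hcon
            exact haA (Finset.mem_filter.2 ⟨haP, hcon.le⟩)
        _ ≤ _ := Finset.sum_le_sum_of_subset_of_nonneg Finset.sdiff_subset
            fun _ _ _ => by positivity
    have h2 : ((P \ A).card : ℝ) * (δ / 2 * n) ≤ n / 2 * (δ / 2 * n) := by nlinarith
    have h3 := le_of_mul_le_mul_right h2 (by positivity)
    have h4 : ((P \ A).card : ℝ) + A.card = n := by
      rw [hn]
      exact_mod_cast Finset.card_sdiff_add_card_eq_card (Finset.filter_subset _ P : A ⊆ P)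
    linarith
  have hplanes : ∀ a ∈ A, c₁ * n ^ 2 ≤ ((spannedPlanes P).filter fun H => a ∈ H).card := by
    intro a ha
    obtain ⟨haP, haA⟩ := Finset.mem_filter.1 ha
    refine hproj P a haP (card_spread_of_plane_bound hδ (by positivity) a) ?_
    intro b hb c hc hab hcl
    set H := planeThrough a b c with hH
    -- Dropping the bad partners costs at most half of the `δ * n` points off `H`. Any remaining `g`
    -- spans with `a` a line of fewer than `K` points, since no line exceeds `β * n`.
    refine ⟨(P \ ptsIn P H) \ bad a, Finset.sdiff_subset.trans Finset.sdiff_subset, ?_, ?_, ?_⟩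
    · intro g hg hgH
      obtain ⟨h1, h2⟩ := Finset.mem_sdiff.1 (Finset.mem_sdiff.1 hg).1
      exact h2 (mem_ptsIn.2 ⟨h1, hgH⟩)
    · have h1 := hδ H (isPlane_planeThrough hab hcl)
      have h2 : ((P \ ptsIn P H).card : ℝ) ≤ ((P \ ptsIn P H) \ bad a).card + (bad a).card := by
        exact_mod_cast Finset.card_le_card_sdiff_add_card
      linarith
    · intro g hg
      obtain ⟨hg1, hg2⟩ := Finset.mem_sdiff.1 hg
      obtain ⟨hgP, hgH⟩ := Finset.mem_sdiff.1 hg1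
      have hag : a ≠ g := fun h => hgH (mem_ptsIn.2 ⟨hgP, h ▸ first_mem_planeThrough a b c⟩)
      refine (Finset.card_le_card (t := ptsIn P line[ℝ, a, g]) fun r hr => ?_).trans ?_
      · obtain ⟨h1, h2⟩ := mem_ptsIn.1 hr
        exact mem_ptsIn.2 ⟨(Finset.mem_sdiff.1 (Finset.mem_sdiff.1 h1).1).1, h2⟩
      · by_contra hcon
        push Not at hcon
        refine hg2 (Finset.mem_filter.2 ⟨hgP, Finset.mem_filter.2
          ⟨Finset.mem_offDiag.2 ⟨haP, hgP, hag⟩, ?_, hline a haP g hgP hag⟩⟩)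
        exact_mod_cast hcon.le
  have h1 := card_mul_le_ordinary (Finset.filter_subset _ P) hplanes
  have h2 : n / 2 * (c₁ * n ^ 2) ≤ 3 * n * (ordinaryFinset P).card :=
    le_trans (by gcongr) h1
  have h3 : n * (c₁ / 6 * n ^ 2) ≤ n * (ordinaryFinset P).card := by linarith
  exact le_of_mul_le_mul_left h3 hn0

open Classical in
/-- Points off a line `pq` whose plane with the line has few points send many ordinary lines to
the line. -/
theorem card_mul_le_ordinary_of_line {P S : Finset Space3} {p q : Space3}
    (hS : S ⊆ P) (hSl : ∀ b ∈ S, b ∉ line[ℝ, p, q]) {m : ℝ}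
    (hm : ∀ b ∈ S, m ≤ ((ptsIn P line[ℝ, p, q]).card : ℝ) -
      (ptsIn P (planeThrough p q b) \ ptsIn P line[ℝ, p, q]).card) :
    S.card * m ≤ (ordinaryFinset P).card := by
  set L := ptsIn P line[ℝ, p, q] with hL
  set T : Space3 → Finset Space3 := fun b => (ptsIn P (planeThrough p q b) \ L).erase b with hT
  -- Lines from `b` to `L` stay in the plane through `b` and `pq`, so only the points of that plane
  -- off `pq` can spoil them.
  set G := (S ×ˢ L).filter fun x => ¬ ∃ t ∈ T x.1, t ∈ line[ℝ, x.2, x.1] with hG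
  have h1 : S.card * m ≤ G.card := by
    rw [Finset.card_eq_sum_card_fiberwise (f := Prod.fst) (t := S)
      fun x hx => (Finset.mem_product.1 (Finset.mem_filter.1 hx).1).1]
    push_cast
    rw [← nsmul_eq_mul]
    refine Finset.card_nsmul_le_sum _ _ _ fun b hb => (hm b hb).trans ?_
    have h2 := card_blocked_le (T := T b) (A := L) (fun a ha => (mem_ptsIn.1 ha).2) (hSl b hb)
      (Finset.notMem_erase _ _)
    have h3 := Finset.card_filter_add_card_filter_not (s := L)
      (fun a => ∃ t ∈ T b, t ∈ line[ℝ, a, b])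
    have h4 : L.filter (fun a => ¬ ∃ t ∈ T b, t ∈ line[ℝ, a, b]) ⊆
        (G.filter fun x => x.1 = b).image Prod.snd := fun a ha =>
      Finset.mem_image.2 ⟨(b, a), Finset.mem_filter.2 ⟨Finset.mem_filter.2
        ⟨Finset.mk_mem_product hb (Finset.mem_filter.1 ha).1, (Finset.mem_filter.1 ha).2⟩, rfl⟩, rfl⟩
    have h5 := (Finset.card_le_card h4).trans Finset.card_image_le
    have h6 : (T b).card ≤ (ptsIn P (planeThrough p q b) \ L).card := Finset.card_erase_le
    rw [sub_le_iff_le_add]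
    have h7 : L.card ≤ (G.filter fun x => x.1 = b).card +
        (ptsIn P (planeThrough p q b) \ L).card := by
      rw [← h3, add_comm]
      exact add_le_add h5 (h2.trans h6)
    exact_mod_cast h7
  have hGmem : ∀ x ∈ G, (x.1 ∈ P ∧ x.1 ∉ line[ℝ, p, q]) ∧ (x.2 ∈ P ∧ x.2 ∈ line[ℝ, p, q]) ∧
      ∀ s ∈ P, s ∈ line[ℝ, x.2, x.1] → s = x.2 ∨ s = x.1 := by
    intro x hx
    obtain ⟨hxm, hxT⟩ := Finset.mem_filter.1 hx
    obtain ⟨hb, ha⟩ := Finset.mem_product.1 hxm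
    rw [mem_ptsIn] at ha
    have hbl := hSl _ hb
    refine ⟨⟨hS hb, hbl⟩, ha, fun s hs hsl => ?_⟩
    by_cases hsL : s ∈ line[ℝ, p, q]
    · left
      rw [Set.pair_comm] at hsl
      exact eq_of_mem_of_notMem hsL ha.2 hbl hsl (right_mem_affineSpan_pair ..)
    · right
      by_contra hne
      refine hxT ⟨s, Finset.mem_erase.2 ⟨hne, Finset.mem_sdiff.2 ⟨mem_ptsIn.2 ⟨hs, ?_⟩,
        fun h => hsL (mem_ptsIn.1 h).2⟩⟩, hsl⟩
      refine affineSpan_pair_le_of_mem_of_mem ?_ (third_mem_planeThrough p q x.1) hsl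
      exact affineSpan_pair_le_of_mem_of_mem (first_mem_planeThrough p q x.1)
        (second_mem_planeThrough p q x.1) ha.2
  refine h1.trans ?_
  norm_cast
  refine Finset.card_le_card_of_injOn (fun x => line[ℝ, x.2, x.1]) ?_ ?_
  · intro x hx
    obtain ⟨⟨hb, hbl⟩, ⟨ha, hal⟩, h⟩ := hGmem x hx
    exact line_mem_ordinaryFinset ha hb (fun h => hbl (h ▸ hal)) h
  · rintro ⟨b, a⟩ hx ⟨b', a'⟩ hx' heq
    obtain ⟨⟨hb, hbl⟩, ⟨ha, hal⟩, h⟩ := hGmem _ hx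
    obtain ⟨⟨hb', hbl'⟩, ⟨ha', hal'⟩, -⟩ := hGmem _ hx'
    simp only at heq hb hbl ha hal hb' hbl' ha' hal' h
    have e1 := h a' ha' (heq ▸ left_mem_affineSpan_pair ℝ a' b')
    have e2 := h b' hb' (heq ▸ right_mem_affineSpan_pair ℝ a' b')
    have e3 : a' = a := e1.resolve_right fun h => hbl (h ▸ hal')
    have e4 : b' = b := e2.resolve_left fun h => hbl' (h ▸ hal)
    rw [e3, e4]

open Classical in
/-- If some line is rich, then there are many ordinary lines. -/
theorem exists_ordinary_ge_of_rich_line {δ β : ℝ} (hδ0 : 0 < δ) (hβ : 0 < β) :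
    ∃ c : ℝ, 0 < c ∧ ∀ P : Finset Space3, 0 < P.card →
      (∀ H, IsPlane H → δ * P.card ≤ ((P \ ptsIn P H).card : ℝ)) →
      (∃ p ∈ P, ∃ q ∈ P, p ≠ q ∧ β * P.card ≤ ((ptsIn P line[ℝ, p, q]).card : ℝ)) →
      c * (P.card : ℝ) ^ 2 ≤ (ordinaryFinset P).card := by
  obtain ⟨c₁, hc₁, hproj⟩ := exists_card_planes_through_ge (show 0 < β / 2 by positivity) one_pos
  refine ⟨min (δ * β / 4) (β * c₁ / 6), by positivity, fun P hP hδ hrich => ?_⟩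
  obtain ⟨p, hp, q, hq, hpq, hL⟩ := hrich
  set n : ℝ := (P.card : ℝ) with hn
  have hn0 : 0 < n := by rw [hn]; exact_mod_cast hP
  set L := ptsIn P line[ℝ, p, q] with hLdef
  have hL2 : 2 ≤ L.card := two_le_card_ptsIn hp hq hpq
  set T : Space3 → Finset Space3 := fun b => ptsIn P (planeThrough p q b) \ L with hT
  have hTmem : ∀ b r, r ∈ T b → r ∈ P ∧ r ∈ planeThrough p q b ∧ r ∉ line[ℝ, p, q] := by
    intro b r hr
    obtain ⟨h1, h2⟩ := Finset.mem_sdiff.1 hr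
    obtain ⟨h3, h4⟩ := mem_ptsIn.1 h1
    exact ⟨h3, h4, fun h => h2 (mem_ptsIn.2 ⟨h3, h⟩)⟩
  set S := (P \ L).filter fun b => ((T b).card : ℝ) ≤ β / 2 * n with hS
  have hoffL : ∀ b ∈ P \ L, b ∉ line[ℝ, p, q] := fun b hb h =>
    (Finset.mem_sdiff.1 hb).2 (mem_ptsIn.2 ⟨(Finset.mem_sdiff.1 hb).1, h⟩)
  rcases le_or_gt (δ / 2 * n) S.card with hbig | hsmall
  · have h1 := card_mul_le_ordinary_of_line (P := P) (S := S) (p := p) (q := q) (m := β / 2 * n)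
      ((Finset.filter_subset _ _).trans Finset.sdiff_subset)
      (fun b hb => hoffL b (Finset.mem_filter.1 hb).1)
      (fun b hb => by have := (Finset.mem_filter.1 hb).2; linarith)
    calc _ ≤ δ * β / 4 * n ^ 2 := by gcongr; exact min_le_left _ _
      _ = δ / 2 * n * (β / 2 * n) := by ring
      _ ≤ S.card * (β / 2 * n) := by gcongr
      _ ≤ _ := h1
  -- More points lie off `H` than `S` contains, so one of them spans a well-filled plane with the
  -- line. Using this twice gives two distinct such planes.
  · have hpick : ∀ H, IsPlane H → line[ℝ, p, q] ≤ H → ∃ b ∈ P, b ∉ line[ℝ, p, q] ∧ b ∉ H ∧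
        β / 2 * n ≤ (T b).card := by
      intro H hH hle
      have h1 : S.card < (P \ ptsIn P H).card := by
        have h2 := hδ H hH
        have h3 : 0 < δ * n := by positivity
        have : (S.card : ℝ) < (P \ ptsIn P H).card := by linarith
        exact_mod_cast this
      obtain ⟨b, hb, hbS⟩ := Finset.exists_mem_notMem_of_card_lt_card h1
      obtain ⟨hbP, hbH⟩ := Finset.mem_sdiff.1 hb
      have hbH' : b ∉ H := fun h => hbH (mem_ptsIn.2 ⟨hbP, h⟩)
      have hbl : b ∉ line[ℝ, p, q] := fun h => hbH' (hle h)
      refine ⟨b, hbP, hbl, hbH', ?_⟩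
      by_contra hcon
      push Not at hcon
      exact hbS (Finset.mem_filter.2 ⟨Finset.mem_sdiff.2
        ⟨hbP, fun h => hbl (mem_ptsIn.1 h).2⟩, hcon.le⟩)
    have hlineplane : ∀ b, line[ℝ, p, q] ≤ planeThrough p q b := fun b =>
      affineSpan_pair_le_of_mem_of_mem (first_mem_planeThrough p q b)
        (second_mem_planeThrough p q b)
    obtain ⟨H₀, hH₀, hp₀, hq₀⟩ := exists_isPlane_mem p q
    obtain ⟨b₁, hb₁P, hb₁l, -, hT₁⟩ := hpick H₀ hH₀ (affineSpan_pair_le_of_mem_of_mem hp₀ hq₀)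
    have hpl₁ := isPlane_planeThrough hpq hb₁l
    obtain ⟨b₂, hb₂P, hb₂l, hb₂, hT₂⟩ := hpick _ hpl₁ (hlineplane b₁)
    have hpl₂ := isPlane_planeThrough hpq hb₂l
    have hsep : ∀ r, r ∉ line[ℝ, p, q] → r ∈ planeThrough p q b₁ → r ∉ planeThrough p q b₂ := by
      intro r hr h1 h2
      have e1 := hpl₁.eq_planeThrough (first_mem_planeThrough _ _ _)
        (second_mem_planeThrough _ _ _) h1 hpq hr
      have e2 := hpl₂.eq_planeThrough (first_mem_planeThrough _ _ _)
        (second_mem_planeThrough _ _ _) h2 hpq hr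
      exact hb₂ (by rw [e1, ← e2]; exact third_mem_planeThrough _ _ _)
    have hplanes : ∀ a ∈ T b₁, c₁ * n ^ 2 ≤ ((spannedPlanes P).filter fun H => a ∈ H).card := by
      intro a ha
      obtain ⟨haP, ha1, hal⟩ := hTmem _ _ ha
      have hfib : ∀ (F : AffineSubspace ℝ Space3) (G : Finset Space3), a ∉ F → (∀ g ∈ G, g ∈ F) →
          ∀ g ∈ G, (ptsIn G line[ℝ, a, g]).card ≤ 1 := by
        intro F G haF hGF g _
        refine Finset.card_le_one.2 fun x hx y hy => ?_
        obtain ⟨hx1, hx2⟩ := mem_ptsIn.1 hx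
        obtain ⟨hy1, hy2⟩ := mem_ptsIn.1 hy
        exact eq_of_mem_of_notMem (hGF x hx1) (hGF y hy1) haF hx2 hy2
      refine hproj P a haP (card_spread_of_plane_bound hδ (by positivity) a) ?_
      intro b hb c hc hab hcl
      have hH := isPlane_planeThrough hab hcl
      have haH := first_mem_planeThrough a b c
      set H := planeThrough a b c
      -- A plane through `a` containing the rich line is the first plane, and then `T b₂` lies off
      -- it; any other contains at most one point of `L`. Both witnesses lie in a flat avoiding `a`,
      -- so each line through `a` meets them at most once.
      by_cases hpqH : p ∈ H ∧ q ∈ H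
      · have e1 : H = planeThrough p q b₁ := by
          rw [hH.eq_planeThrough hpqH.1 hpqH.2 haH hpq hal]
          exact (hpl₁.eq_planeThrough (first_mem_planeThrough _ _ _)
            (second_mem_planeThrough _ _ _) ha1 hpq hal).symm
        refine ⟨T b₂, fun r hr => (hTmem _ _ hr).1, fun g hg hgH => ?_, hT₂,
          hfib (planeThrough p q b₂) _ (hsep a hal ha1) fun g hg => (hTmem _ _ hg).2.1⟩
        obtain ⟨-, hg2, hg3⟩ := hTmem _ _ hg
        exact hsep g hg3 (e1 ▸ hgH) hg2
      · refine ⟨L \ ptsIn L H, Finset.sdiff_subset.trans (ptsIn_subset _ _), ?_, ?_,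
          hfib line[ℝ, p, q] _ hal
            fun g hg => (mem_ptsIn.1 (Finset.mem_sdiff.1 hg).1).2⟩
        · intro g hg hgH
          obtain ⟨h1, h2⟩ := Finset.mem_sdiff.1 hg
          exact h2 (mem_ptsIn.2 ⟨h1, hgH⟩)
        · have h1 : (ptsIn L H).card ≤ 1 := by
            refine Finset.card_le_one.2 fun x hx y hy => ?_
            obtain ⟨hx1, hx2⟩ := mem_ptsIn.1 hx
            obtain ⟨hy1, hy2⟩ := mem_ptsIn.1 hy
            by_contra hne
            have e := line_eq_of_mem (mem_ptsIn.1 hx1).2 (mem_ptsIn.1 hy1).2 hne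
            have hle : line[ℝ, p, q] ≤ H := e ▸ affineSpan_pair_le_of_mem_of_mem hx2 hy2
            exact hpqH ⟨hle (left_mem_affineSpan_pair ..), hle (right_mem_affineSpan_pair ..)⟩
          have h2 := Finset.card_sdiff_of_subset (ptsIn_subset L H)
          have h3 : L.card ≤ 2 * (L \ ptsIn L H).card := by omega
          have h3' : (L.card : ℝ) ≤ 2 * (L \ ptsIn L H).card := by exact_mod_cast h3
          linarith
    have h1 := card_mul_le_ordinary (fun r hr => (hTmem _ _ hr).1) hplanes
    have h2 : β / 2 * n * (c₁ * n ^ 2) ≤ 3 * n * (ordinaryFinset P).card :=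
      le_trans (by gcongr) h1
    have h3 : n * (β * c₁ / 6 * n ^ 2) ≤ n * (ordinaryFinset P).card := by linarith
    calc _ ≤ β * c₁ / 6 * n ^ 2 := by gcongr; exact min_le_right _ _
      _ ≤ _ := le_of_mul_le_mul_left h3 hn0

theorem theorem1p3 :
    ∀ α : ℝ, α < 1 → ∃ c : ℝ, 0 < c ∧
      ∀ P : Finset Space3,
        (∀ p : AffineSubspace ℝ Space3, IsPlane p →
          (((P : Set Space3) ∩ (p : Set Space3)).ncard : ℝ) ≤ α * (P.card : ℝ)) →
        c * (P.card : ℝ) ^ 2 ≤ ((ordinaryLines P).ncard : ℝ) := by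
  intro α hα
  have hδ0 : 0 < 1 - α := by linarith
  -- The case without rich lines fixes the threshold `β`; the other case works for any positive
  -- threshold.
  obtain ⟨β, hβ, c₁, hc₁, h₁⟩ := exists_ordinary_ge_of_no_rich_line hδ0
  obtain ⟨c₂, hc₂, h₂⟩ := exists_ordinary_ge_of_rich_line hδ0 hβ
  refine ⟨min c₁ c₂, lt_min hc₁ hc₂, fun P hP => ?_⟩
  classical
  rw [ncard_ordinaryLines]
  rcases Nat.eq_zero_or_pos P.card with h0 | hpos
  · rw [h0]; simp
  have hδ : ∀ H, IsPlane H → (1 - α) * P.card ≤ ((P \ ptsIn P H).card : ℝ) := by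
    intro H hH
    have h3 := hP H hH
    rw [ncard_inter] at h3
    have h4 : ((P \ ptsIn P H).card : ℝ) + (ptsIn P H).card = P.card := by
      exact_mod_cast Finset.card_sdiff_add_card_eq_card (ptsIn_subset P H)
    linarith
  by_cases hrich : ∃ p ∈ P, ∃ q ∈ P, p ≠ q ∧
      β * P.card ≤ ((ptsIn P line[ℝ, p, q]).card : ℝ)
  · refine le_trans ?_ (h₂ P hpos (by convert hδ) hrich)
    gcongr
    exact min_le_right _ _
  · push Not at hrich
    refine le_trans ?_ (h₁ P hpos (by convert hδ) fun p hp q hq hpq => (hrich p hp q hq hpq).le)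
    gcongr
    exact min_le_left _ _
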